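/- Let $R$ be a commutative unital ring, let $A$ and $B$ be unital $R$-algebras, $M$ an $(A,B)$-bimodule and $N$ a $(B,A)$-bimodule (over $R$), at least one of $M,N$ being nonzero, and let $\Phi:M\otimes_B N\to A$ and $\Psi:N\otimes_A M\to B$ be bimodule homomorphisms such that, writing $mn=\Phi(m\otimes n)$ and $nm=\Psi(n\otimes m)$, one has $(mn)m'=m(nm')$ and $(nm)n'=n(mn')$ for all $m,m'\in M$, $n,n'\in N$. Let $$\mathcal G=\begin{pmatrix}A&M\\N&B\end{pmatrix}$$ be the resulting generalized matrix algebra (with the usual matrix operations), with the projections $\pi_A:\mathcal G\to A$ and $\pi_B:\mathcal G\to B$ onto the diagonal corners. Write $Z(\cdot)$ for the center, and $[x,y]=xy-yx$. Assume that $M$ and $N$ are $2$-torsion free ($2m=0$ implies $m=0$, and $2n=0$ implies $n=0$), and that $\mathcal G$ is weakly faithful: $aM=0=Na$ implies $a=0$ for $a\in A$, and $Mb=0=bN$ implies $b=0$ for $b\in B$. Call an $(A,B)$-bimodule $M$ strongly faithful if either ($Mb=0$ implies $b=0$ for all $b\in B$, and $am=0$ implies $a=0$ or $m=0$ for all $a\in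 A$, $m\in M$), or ($aM=0$ implies $a=0$ for all $a\in A$, and $mb=0$ implies $m=0$ or $b=0$ for all $m\in M$, $b\in B$); for the $(B,A)$-bimodule $N$ the definition is the same with $A$ and $B$ interchanged. Suppose that (I) $\pi_A(Z(\mathcal G))=Z(A)$ and $\pi_B(Z(\mathcal G))=Z(B)$, and (II) at least one of the following holds: (i) $A$ or $B$ contains no nonzero central ideal (two-sided ideal contained in the center); (ii) $A$ and $B$ both have no zero divisors ($xy=0$ implies $x=0$ or $y=0$); (iii) $M$ or $N$ is strongly faithful. Then every Lie higher derivation on $\mathcal G$ is proper. That is, let $(\mathcal L_k)_{k\ge 0}$ be $R$-linear maps $\mathcal G\to\mathcal G$ with $\mathcal L_0=\mathrm{id}$ and $\mathcal L_k([x,y])=\sum_{i+j=k}[\mathcal L_i(x),\mathcal L_j(y)]$ for all $k\ge 0$ and $x,y\in\mathcal G$. Then there are $R$-linear maps $(\mathcal D_k)_{k\ge0}$ on $\mathcal G$ with $\mathcal D_0=\mathrm{id}$ and $\mathcal D_k(xy)=\sum_{i+j=k}\mathcal D_i(x)\mathcal D_j(y)$ for all $k\ge0$ and $x,y\in\mathcal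 G$, and $R$-linear maps $(\tau_k)_{k\ge1}$ on $\mathcal G$ with $\tau_k(\mathcal G)\subseteq Z(\mathcal G)$ and $\tau_k([x,y])=0$ for all $k\ge1$ and $x,y\in\mathcal G$, such that $\mathcal L_k=\mathcal D_k+\tau_k$ for all $k\ge1$. -/

import Mathlib

open MulOpposite

section HigherDerivations

variable (R : Type*) [CommRing R] (A : Type*) [Ring A] [Algebra R A]

/-- A higher derivation of an `R`-algebra: a sequence of linear maps `D k`, `k ≥ 0`, with `D 0 = id`
and `D k (x y) = ∑_{i+j=k} D i x * D j y`. -/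
structure IsHigherDerivation (D : ℕ → A →ₗ[R] A) : Prop where
  zero : D 0 = LinearMap.id
  map_mul : ∀ (k : ℕ) (x y : A),
    D k (x * y) = ∑ p ∈ Finset.HasAntidiagonal.antidiagonal k, D p.1 x * D p.2 y

/-- A Lie higher derivation of an `R`-algebra; here `⁅x, y⁆ = x * y - y * x`. -/
structure IsLieHigherDerivation (L : ℕ → A →ₗ[R] A) : Prop where
  zero : L 0 = LinearMap.id
  map_lie : ∀ (k : ℕ) (x y : A),
    L k ⁅x, y⁆ = ∑ p ∈ Finset.HasAntidiagonal.antidiagonal k, ⁅L p.1 x, L p.2 y⁆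

/-- A sequence `L` is proper if there are a higher derivation `D` and linear maps `τ k`, `k ≥ 1`,
with values in the center and vanishing on commutators, such that `L k = D k + τ k` for `k ≥ 1`.
(The value `τ 0` is irrelevant; for a Lie higher derivation `L 0 = id = D 0` holds anyway.) -/
def IsProper (L : ℕ → A →ₗ[R] A) : Prop :=
  ∃ D τ : ℕ → A →ₗ[R] A,
    IsHigherDerivation R A D ∧
    (∀ k, 0 < k → ∀ x, τ k x ∈ Set.center A) ∧
    (∀ k, 0 < k → ∀ x y : A, τ k ⁅x, y⁆ = 0) ∧
    (∀ k, 0 < k → L k = D k + τ k)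

/-- The Lie higher derivation property: every Lie higher derivation is proper. -/
def HasLHDProperty : Prop :=
  ∀ L : ℕ → A →ₗ[R] A, IsLieHigherDerivation R A L → IsProper R A L

end HigherDerivations

/-- The ring has no nonzero (two-sided) ideal contained in its center. -/
def HasNoNonzeroCentralIdeal (A : Type*) [Ring A] : Prop :=
  ∀ I : TwoSidedIdeal A, (∀ x ∈ I, x ∈ Set.center A) → I = ⊥

/-- Strong faithfulness of an `(A, B)`-bimodule `M`. The right action of `b : B` on `m : M` is
`op b • m`. -/
def IsStronglyFaithful (A B M : Type*) [Ring A] [Ring B] [AddCommGroup M]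
    [Module A M] [Module Bᵐᵒᵖ M] : Prop :=
  ((∀ b : B, (∀ m : M, op b • m = 0) → b = 0) ∧
      ∀ (a : A) (m : M), a • m = 0 → a = 0 ∨ m = 0) ∨
    ((∀ a : A, (∀ m : M, a • m = 0) → a = 0) ∧
      ∀ (m : M) (b : B), op b • m = 0 → m = 0 ∨ b = 0)

/-- A Morita context `(A, B, M, N, Φ, Ψ)` over `R`. The right actions of `B` on `M` and of `A` on `N`
are given by modules over the opposite rings. A bimodule homomorphism `M ⊗_B N → A` is given by the
corresponding `B`-balanced bilinear map `Φ`, and similarly for `Ψ`. -/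
structure MoritaContext (R A B M N : Type*) [CommRing R]
    [Ring A] [Algebra R A] [Ring B] [Algebra R B]
    [AddCommGroup M] [Module R M] [Module A M] [Module Bᵐᵒᵖ M]
    [AddCommGroup N] [Module R N] [Module B N] [Module Aᵐᵒᵖ N] where
  /-- the pairing `M ⊗_B N → A` -/
  Φ : M →ₗ[R] N →ₗ[R] A
  /-- the pairing `N ⊗_A M → B` -/
  Ψ : N →ₗ[R] M →ₗ[R] B
  Φ_balanced : ∀ (m : M) (b : B) (n : N), Φ (op b • m) n = Φ m (b • n)
  Φ_left : ∀ (a : A) (m : M) (n : N), Φ (a • m) n = a * Φ m n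
  Φ_right : ∀ (m : M) (n : N) (a : A), Φ m (op a • n) = Φ m n * a
  Ψ_balanced : ∀ (n : N) (a : A) (m : M), Ψ (op a • n) m = Ψ n (a • m)
  Ψ_left : ∀ (b : B) (n : N) (m : M), Ψ (b • n) m = b * Ψ n m
  Ψ_right : ∀ (n : N) (m : M) (b : B), Ψ n (op b • m) = Ψ n m * b
  assoc_M : ∀ (m : M) (n : N) (m' : M), Φ m n • m' = op (Ψ n m') • m
  assoc_N : ∀ (n : N) (m : M) (n' : N), Ψ n m • n' = op (Φ m n') • n

section GeneralizedMatrixAlgebra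

variable {R A B M N : Type*} [CommRing R]
  [Ring A] [Algebra R A] [Ring B] [Algebra R B]
  [AddCommGroup M] [Module R M] [Module A M] [Module Bᵐᵒᵖ M]
  [AddCommGroup N] [Module R N] [Module B N] [Module Aᵐᵒᵖ N]

/-- The generalized matrix algebra of a Morita context: the matrices with entries
`a11 : A`, `a12 : M`, `a21 : N`, `a22 : B`. -/
@[ext]
structure GenMatrixAlgebra (c : MoritaContext R A B M N) where
  a11 : A
  a12 : M
  a21 : N
  a22 : B

namespace GenMatrixAlgebra

variable {c : MoritaContext R A B M N}

instance : Zero (GenMatrixAlgebra c) := ⟨⟨0, 0, 0, 0⟩⟩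
instance : One (GenMatrixAlgebra c) := ⟨⟨1, 0, 0, 1⟩⟩
instance : Add (GenMatrixAlgebra c) :=
  ⟨fun x y => ⟨x.a11 + y.a11, x.a12 + y.a12, x.a21 + y.a21, x.a22 + y.a22⟩⟩
instance : Neg (GenMatrixAlgebra c) := ⟨fun x => ⟨-x.a11, -x.a12, -x.a21, -x.a22⟩⟩
instance : SMul R (GenMatrixAlgebra c) :=
  ⟨fun r x => ⟨r • x.a11, r • x.a12, r • x.a21, r • x.a22⟩⟩
/-- Matrix multiplication, with the products `M × N → A` and `N × M → B` given by `Φ` and `Ψ`. -/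
instance : Mul (GenMatrixAlgebra c) :=
  ⟨fun x y =>
    ⟨x.a11 * y.a11 + c.Φ x.a12 y.a21,
     x.a11 • y.a12 + op y.a22 • x.a12,
     op y.a11 • x.a21 + x.a22 • y.a21,
     c.Ψ x.a21 y.a12 + x.a22 * y.a22⟩⟩

@[simp] theorem zero_a11 : (0 : GenMatrixAlgebra c).a11 = 0 := rfl
@[simp] theorem zero_a12 : (0 : GenMatrixAlgebra c).a12 = 0 := rfl
@[simp] theorem zero_a21 : (0 : GenMatrixAlgebra c).a21 = 0 := rfl
@[simp] theorem zero_a22 : (0 : GenMatrixAlgebra c).a22 = 0 := rfl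
@[simp] theorem one_a11 : (1 : GenMatrixAlgebra c).a11 = 1 := rfl
@[simp] theorem one_a12 : (1 : GenMatrixAlgebra c).a12 = 0 := rfl
@[simp] theorem one_a21 : (1 : GenMatrixAlgebra c).a21 = 0 := rfl
@[simp] theorem one_a22 : (1 : GenMatrixAlgebra c).a22 = 1 := rfl
@[simp] theorem add_a11 (x y : GenMatrixAlgebra c) : (x + y).a11 = x.a11 + y.a11 := rfl
@[simp] theorem add_a12 (x y : GenMatrixAlgebra c) : (x + y).a12 = x.a12 + y.a12 := rfl
@[simp] theorem add_a21 (x y : GenMatrixAlgebra c) : (x + y).a21 = x.a21 + y.a21 := rfl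
@[simp] theorem add_a22 (x y : GenMatrixAlgebra c) : (x + y).a22 = x.a22 + y.a22 := rfl
@[simp] theorem neg_a11 (x : GenMatrixAlgebra c) : (-x).a11 = -x.a11 := rfl
@[simp] theorem neg_a12 (x : GenMatrixAlgebra c) : (-x).a12 = -x.a12 := rfl
@[simp] theorem neg_a21 (x : GenMatrixAlgebra c) : (-x).a21 = -x.a21 := rfl
@[simp] theorem neg_a22 (x : GenMatrixAlgebra c) : (-x).a22 = -x.a22 := rfl
@[simp] theorem smul_a11 (r : R) (x : GenMatrixAlgebra c) : (r • x).a11 = r • x.a11 := rfl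
@[simp] theorem smul_a12 (r : R) (x : GenMatrixAlgebra c) : (r • x).a12 = r • x.a12 := rfl
@[simp] theorem smul_a21 (r : R) (x : GenMatrixAlgebra c) : (r • x).a21 = r • x.a21 := rfl
@[simp] theorem smul_a22 (r : R) (x : GenMatrixAlgebra c) : (r • x).a22 = r • x.a22 := rfl
@[simp] theorem mul_a11 (x y : GenMatrixAlgebra c) :
    (x * y).a11 = x.a11 * y.a11 + c.Φ x.a12 y.a21 := rfl
@[simp] theorem mul_a12 (x y : GenMatrixAlgebra c) :
    (x * y).a12 = x.a11 • y.a12 + op y.a22 • x.a12 := rfl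
@[simp] theorem mul_a21 (x y : GenMatrixAlgebra c) :
    (x * y).a21 = op y.a11 • x.a21 + x.a22 • y.a21 := rfl
@[simp] theorem mul_a22 (x y : GenMatrixAlgebra c) :
    (x * y).a22 = c.Ψ x.a21 y.a12 + x.a22 * y.a22 := rfl

instance : AddCommGroup (GenMatrixAlgebra c) where
  add_assoc x y z := by ext <;> simp [add_assoc]
  zero_add x := by ext <;> simp
  add_zero x := by ext <;> simp
  add_comm x y := by ext <;> simp [add_comm]
  neg_add_cancel x := by ext <;> simp
  nsmul := nsmulRec
  zsmul := zsmulRec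

instance [SMulCommClass A Bᵐᵒᵖ M] [SMulCommClass B Aᵐᵒᵖ N] : Ring (GenMatrixAlgebra c) where
  __ := (inferInstance : AddCommGroup (GenMatrixAlgebra c))
  left_distrib x y z := by ext <;> simp [mul_add, add_smul] <;> abel
  right_distrib x y z := by ext <;> simp [add_mul, add_smul] <;> abel
  zero_mul x := by ext <;> simp
  mul_zero x := by ext <;> simp
  one_mul x := by ext <;> simp
  mul_one x := by ext <;> simp
  mul_assoc x y z := by
    ext
    · simp [add_mul, mul_add, mul_assoc, c.Φ_left, c.Φ_right, c.Φ_balanced]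
      abel
    · simp [mul_smul, add_smul, smul_add, c.assoc_M, smul_comm x.a11 (op z.a22)]
      abel
    · simp [mul_smul, add_smul, smul_add, c.assoc_N, smul_comm x.a22 (op z.a11)]
      abel
    · simp [add_mul, mul_add, mul_assoc, c.Ψ_left, c.Ψ_right, c.Ψ_balanced]
      abel

instance : Module R (GenMatrixAlgebra c) where
  one_smul x := by ext <;> simp
  mul_smul r s x := by ext <;> simp [mul_smul]
  smul_zero r := by ext <;> simp
  smul_add r x y := by ext <;> simp
  add_smul r s x := by ext <;> simp [add_smul]
  zero_smul x := by ext <;> simp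

instance [SMulCommClass A Bᵐᵒᵖ M] [SMulCommClass B Aᵐᵒᵖ N]
    [IsScalarTower R A M] [IsScalarTower R Bᵐᵒᵖ M]
    [IsScalarTower R B N] [IsScalarTower R Aᵐᵒᵖ N] : Algebra R (GenMatrixAlgebra c) :=
  Algebra.ofModule
    (fun r x y => by ext <;> simp [smul_comm _ r])
    (fun r x y => by ext <;> simp [smul_comm _ r])

variable (c) in
/-- The projection onto the upper left corner. -/
def πA : GenMatrixAlgebra c →ₗ[R] A where
  toFun x := x.a11
  map_add' _ _ := rfl
  map_smul' _ _ := rfl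

variable (c) in
/-- The projection onto the lower right corner. -/
def πB : GenMatrixAlgebra c →ₗ[R] B where
  toFun x := x.a22
  map_add' _ _ := rfl
  map_smul' _ _ := rfl

/-- Weak faithfulness: `aM = 0 = Na` implies `a = 0`, and `Mb = 0 = bN` implies `b = 0`. -/
def IsWeaklyFaithful (_c : MoritaContext R A B M N) : Prop :=
  (∀ a : A, (∀ m : M, a • m = 0) → (∀ n : N, op a • n = 0) → a = 0) ∧
    ∀ b : B, (∀ m : M, op b • m = 0) → (∀ n : N, b • n = 0) → b = 0

end GenMatrixAlgebra

end GeneralizedMatrixAlgebra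

/-! A Lie higher derivation `L` on a ring `G` is the same thing as a linear map `φ x = ∑ L k x * X ^
k` into `G[[X]]` that reduces to the identity modulo `X` and preserves commutators. Higher
derivations correspond in the same way to multiplicative maps, so the task is to write `φ` as a
multiplicative map plus a map with central coefficients that kills commutators.

Let `e`, `f` be the diagonal idempotents. Conjugation by a unit with constant term `1` makes the
image of `e` diagonal (`exists_unit_conj_commute`). The resulting map `ψ` then respects the
off-diagonal corners, which are told apart by the commutator with `ψ e`, and sends diagonal elements
to diagonal series. For `a` in the corner of `e`, the unwanted part `f * ψ a` is central in the
corner of `f`, because `a` commutes with that corner. Hypothesis (I) and weak faithfulness lift it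
uniquely to a central series, and subtracting such lifts gives a corner-preserving `D`
(`exists_isPeirceDeformation`).

Products with an off-diagonal factor and a diagonal one are commutators, so `D` preserves them; weak
faithfulness extends this to products inside a diagonal corner. What remains is the central series
`lieDefect D m n` for `m`, `n` in opposite off-diagonal corners. Its lowest nonzero coefficient
either annihilates `m` and `n` or generates a central ideal in a diagonal corner, and each
alternative in (II) excludes one of these. Hence `D` is multiplicative, and conjugating back keeps
the central difference unchanged. -/

namespace PowerSeries

/-! ### Fixed points in the `X`-adic topology. -/

section FixedPoint

variable {G : Type*} [Ring G]

/-- Two power series agree below degree `n`. -/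
def AgreeBelow (n : ℕ) (x y : PowerSeries G) : Prop := ∀ j < n, coeff j x = coeff j y

namespace AgreeBelow

variable {n : ℕ} {x y x' y' : PowerSeries G}

theorem refl (n : ℕ) (x : PowerSeries G) : AgreeBelow n x x := fun _ _ => rfl

theorem trans {z : PowerSeries G} (h : AgreeBelow n x y) (h' : AgreeBelow n y z) :
    AgreeBelow n x z := fun j hj => (h j hj).trans (h' j hj)

theorem mono {m : ℕ} (hmn : m ≤ n) (h : AgreeBelow n x y) : AgreeBelow m x y :=
  fun j hj => h j (hj.trans_le hmn)

theorem add (h : AgreeBelow n x y) (h' : AgreeBelow n x' y') :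
    AgreeBelow n (x + x') (y + y') := fun j hj => by simp [h j hj, h' j hj]

theorem sub (h : AgreeBelow n x y) (h' : AgreeBelow n x' y') :
    AgreeBelow n (x - x') (y - y') := fun j hj => by simp [h j hj, h' j hj]

theorem mul (h : AgreeBelow n x y) (h' : AgreeBelow n x' y') :
    AgreeBelow n (x * x') (y * y') := fun j hj => by
  rw [coeff_mul, coeff_mul]
  refine Finset.sum_congr rfl fun p hp => ?_
  have := Finset.HasAntidiagonal.mem_antidiagonal.1 hp
  rw [h _ (by omega), h' _ (by omega)]

theorem X_mul (h : AgreeBelow n x y) : AgreeBelow (n + 1) (X * x) (X * y) := fun j hj => by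
  cases j with
  | zero => simp
  | succ j => simp only [coeff_succ_X_mul]; exact h j (by omega)

end AgreeBelow

/-- A nonexpansive self-map `K` of power series has a solution of `w = X * K w`. -/
theorem exists_eq_X_mul (K : PowerSeries G → PowerSeries G)
    (hK : ∀ n x y, AgreeBelow n x y → AgreeBelow n (K x) (K y)) :
    ∃ w, w = X * K w := by
  let x : ℕ → PowerSeries G := fun n => (fun y => X * K y)^[n] 0
  have hx : ∀ n, x (n + 1) = X * K (x n) := fun n => Function.iterate_succ_apply' _ _ _
  have hstep : ∀ n, AgreeBelow n (x n) (x (n + 1)) := by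
    intro n
    induction n with
    | zero => intro j hj; omega
    | succ n ih =>
      rw [hx n, hx (n + 1)]
      exact (hK _ _ _ ih).X_mul
  have hle : ∀ n k, AgreeBelow n (x n) (x (n + k)) := by
    intro n k
    induction k with
    | zero => exact .refl _ _
    | succ k ih => exact ih.trans ((hstep (n + k)).mono (by omega))
  -- Iterates from `x (n + 1)` on agree below degree `n + 1`, so their coefficient of degree `n` has
  -- stabilised.
  let w : PowerSeries G := mk fun n => coeff n (x (n + 1))
  have hw : ∀ n, AgreeBelow n w (x n) := by
    intro n j hj
    obtain ⟨k, rfl⟩ := Nat.exists_eq_add_of_le (Nat.succ_le_of_lt hj)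
    simpa [w] using hle (j + 1) k j (Nat.lt_succ_self j)
  refine ⟨w, ext fun n => ?_⟩
  have h1 := hw (n + 1) n (Nat.lt_succ_self n)
  have h2 := ((hK _ _ _ (hw n)).X_mul) n (Nat.lt_succ_self n)
  rw [h1, h2, hx n]

end FixedPoint

/-! ### Leading coefficient arguments for noncommutative power series. -/

section Coefficients

variable {G : Type*} [Ring G]

/-- Leading coefficient argument: a convolution with injective leading term has no kernel. -/
theorem eq_zero_of_sum_antidiagonal_eq_zero {P : G → Prop} {T : ℕ → G → G} {s : ℕ → G}
    (hT : ∀ n, T n 0 = 0) (h0 : ∀ x, P x → T 0 x = 0 → x = 0) (hs : ∀ n, P (s n))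
    (h : ∀ n, ∑ p ∈ Finset.HasAntidiagonal.antidiagonal n, T p.1 (s p.2) = 0) (n : ℕ) : s n = 0 := by
  induction n using Nat.strong_induction_on with
  | _ n ih =>
    refine h0 _ (hs n) ?_
    rw [← h n, Finset.sum_eq_single (0, n)]
    · rintro ⟨i, j⟩ hp hne
      have hij : i + j = n := Finset.HasAntidiagonal.mem_antidiagonal.1 hp
      have hi : i ≠ 0 := fun hi => hne (by simp_all)
      simp only
      rw [ih j (by omega), hT]
    · simp

/-- A convolution that annihilates all series `x + ⋯` annihilates all `x`, coefficientwise. -/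
theorem apply_eq_zero_of_sum_antidiagonal_eq_zero {P : G → Prop} {T : ℕ → G → G} {s : ℕ → G → G}
    (hs : ∀ n x, P x → P (s n x)) (h0 : ∀ x, P x → s 0 x = x)
    (h : ∀ n x, P x → ∑ p ∈ Finset.HasAntidiagonal.antidiagonal n, T p.1 (s p.2 x) = 0) (n : ℕ) :
    ∀ x, P x → T n x = 0 := by
  induction n using Nat.strong_induction_on with
  | _ n ih =>
    intro x hx
    have := h n x hx
    rw [Finset.sum_eq_single (n, 0)] at this
    · simpa [h0 x hx] using this
    · rintro ⟨i, j⟩ hp hne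
      have hij : i + j = n := Finset.HasAntidiagonal.mem_antidiagonal.1 hp
      have hi : i ≠ n := fun hi => hne (by ext <;> simp <;> omega)
      exact ih i (by omega) _ (hs _ _ hx)
    · simp

theorem coeff_smul_of_module {R : Type*} [CommRing R] [Module R G] (n : ℕ) (r : R)
    (s : PowerSeries G) : coeff n (r • s) = r • coeff n s := rfl

/-- The lowest coefficient of a product. -/
theorem coeff_mul_of_forall_lt {s t : PowerSeries G} {n : ℕ} (hs : ∀ j < n, coeff j s = 0) :
    coeff n (s * t) = coeff n s * coeff 0 t := by
  rw [coeff_mul, Finset.sum_eq_single (n, 0)]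
  · rintro ⟨i, j⟩ hp hne
    have hij : i + j = n := Finset.HasAntidiagonal.mem_antidiagonal.1 hp
    have hi : i ≠ n := fun hi => hne (by ext <;> simp <;> omega)
    simp only
    rw [hs i (by omega), zero_mul]
  · simp

theorem coeff_zero_mul (s t : PowerSeries G) : coeff 0 (s * t) = coeff 0 s * coeff 0 t :=
  coeff_mul_of_forall_lt fun _ hj => (Nat.not_lt_zero _ hj).elim

theorem coeff_zero_units_inv {u : (PowerSeries G)ˣ} (hu : coeff 0 (u : PowerSeries G) = 1) :
    coeff 0 ((u⁻¹ : (PowerSeries G)ˣ) : PowerSeries G) = 1 := by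
  have := congrArg (coeff 0) u.inv_mul
  rwa [coeff_zero_mul, hu, mul_one, coeff_zero_one] at this

theorem coeff_mul_sub_mul (n : ℕ) (s t u : PowerSeries G) :
    coeff n (s * t - t * u) =
      ∑ p ∈ Finset.HasAntidiagonal.antidiagonal n, (coeff p.1 s * coeff p.2 t - coeff p.2 t * coeff p.1 u) := by
  rw [map_sub, coeff_mul, coeff_mul, Finset.sum_sub_distrib,
    ← Finset.Nat.sum_antidiagonal_swap (f := fun p => coeff p.1 t * coeff p.2 u)]
  rfl

/-- A Sylvester equation `s * t = t * u` whose leading term is injective has only the solution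
`t = 0`. -/
theorem eq_zero_of_mul_eq_mul {P : G → Prop} {s t u : PowerSeries G} (ht : ∀ n, P (coeff n t))
    (h0 : ∀ x, P x → coeff 0 s * x = x * coeff 0 u → x = 0) (h : s * t = t * u) : t = 0 := by
  ext n
  rw [map_zero]
  refine eq_zero_of_sum_antidiagonal_eq_zero (P := P) (s := fun n => coeff n t)
    (T := fun n x => coeff n s * x - x * coeff n u) (by simp)
    (fun x hx hx' => h0 x hx (sub_eq_zero.1 hx')) ht (fun n => ?_) n
  rw [← coeff_mul_sub_mul, h, sub_self, map_zero]

variable {P : G → Prop} {φ : G → PowerSeries G}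

/-- If `s * φ x = φ x * u` for all series `φ x = x + ⋯`, then this holds for the coefficients of
`s` and `u` and all `x`. -/
theorem coeff_mul_eq_mul_coeff {s u : PowerSeries G} (hφ : ∀ n x, P x → P (coeff n (φ x)))
    (h0 : ∀ x, P x → coeff 0 (φ x) = x) (h : ∀ x, P x → s * φ x = φ x * u) (n : ℕ) {x : G}
    (hx : P x) : coeff n s * x = x * coeff n u := by
  refine sub_eq_zero.1 (apply_eq_zero_of_sum_antidiagonal_eq_zero (P := P)
    (s := fun n x => coeff n (φ x)) (T := fun n x => coeff n s * x - x * coeff n u) hφ h0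
    (fun n x hx => ?_) n x hx)
  rw [← coeff_mul_sub_mul, h x hx, sub_self, map_zero]

theorem coeff_mul_eq_zero {s : PowerSeries G} (hφ : ∀ n x, P x → P (coeff n (φ x)))
    (h0 : ∀ x, P x → coeff 0 (φ x) = x) (h : ∀ x, P x → s * φ x = 0) (n : ℕ) {x : G}
    (hx : P x) : coeff n s * x = 0 := by
  simpa using coeff_mul_eq_mul_coeff (u := 0) hφ h0 (by simpa using h) n hx

theorem mul_coeff_eq_zero {s : PowerSeries G} (hφ : ∀ n x, P x → P (coeff n (φ x)))
    (h0 : ∀ x, P x → coeff 0 (φ x) = x) (h : ∀ x, P x → φ x * s = 0) (n : ℕ) {x : G}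
    (hx : P x) : x * coeff n s = 0 := by
  simpa using (coeff_mul_eq_mul_coeff (s := 0) (u := s) hφ h0
    (fun x hx => by rw [zero_mul, h x hx]) n hx).symm

theorem commute_of_coeff_mem_center {s : PowerSeries G} (hs : ∀ n, coeff n s ∈ Set.center G)
    (t : PowerSeries G) : s * t = t * s := by
  rw [← sub_eq_zero]
  ext n
  rw [coeff_mul_sub_mul, map_zero]
  exact Finset.sum_eq_zero fun p _ => sub_eq_zero.2 ((Set.mem_center_iff.1 (hs p.1)).comm _)

theorem commute_C_iff {s : PowerSeries G} {e : G} :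
    s * C e = C e * s ↔ ∀ n, coeff n s * e = e * coeff n s := by
  simp [PowerSeries.ext_iff]

end Coefficients

end PowerSeries

/-! ### Peirce decomposition. -/

section Corners

/-- The corner `i G j` for idempotents `i` and `j`. -/
def InCorner {G : Type*} [Mul G] (i j x : G) : Prop := i * x = x ∧ x * j = x

/-- Two orthogonal idempotents with sum `1`. -/
structure IsPeircePair {G : Type*} [Ring G] (e f : G) : Prop where
  ee : e * e = e
  ff : f * f = f
  ef : e * f = 0
  fe : f * e = 0
  add : e + f = 1

variable {G : Type*} [Ring G] {e f : G}

namespace IsPeircePair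

theorem symm (h : IsPeircePair e f) : IsPeircePair f e :=
  ⟨h.ff, h.ee, h.fe, h.ef, by rw [add_comm, h.add]⟩

theorem powerSeries (h : IsPeircePair e f) : IsPeircePair (PowerSeries.C e) (PowerSeries.C f) := by
  constructor <;> simp only [← map_mul, ← map_add, h.ee, h.ff, h.ef, h.fe, h.add, map_zero, map_one]

theorem decomp (h : IsPeircePair e f) (x : G) :
    x = e * x * e + e * x * f + f * x * e + f * x * f := by
  calc x = (e + f) * x * (e + f) := by simp [h.add]
    _ = _ := by noncomm_ring

end IsPeircePair

theorem inCorner_mul_mul {i j : G} (hi : i * i = i) (hj : j * j = j) (x : G) :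
    InCorner i j (i * x * j) := by
  constructor
  · rw [← mul_assoc, ← mul_assoc, hi]
  · rw [mul_assoc, hj]

/-- An additively closed property that holds on the four corners holds everywhere. -/
theorem IsPeircePair.induction (h : IsPeircePair e f) {P : G → Prop}
    (hadd : ∀ x y, P x → P y → P (x + y)) (hee : ∀ x, InCorner e e x → P x)
    (hef : ∀ x, InCorner e f x → P x) (hfe : ∀ x, InCorner f e x → P x)
    (hff : ∀ x, InCorner f f x → P x) (x : G) : P x := by
  rw [h.decomp x]
  exact hadd _ _ (hadd _ _ (hadd _ _ (hee _ (inCorner_mul_mul h.ee h.ee x))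
    (hef _ (inCorner_mul_mul h.ee h.ff x))) (hfe _ (inCorner_mul_mul h.ff h.ee x)))
    (hff _ (inCorner_mul_mul h.ff h.ff x))

theorem InCorner.sub {i j x y : G} (hx : InCorner i j x) (hy : InCorner i j y) :
    InCorner i j (x - y) := by
  constructor
  · rw [mul_sub, hx.1, hy.1]
  · rw [sub_mul, hx.2, hy.2]

theorem InCorner.mul {i j k x y : G} (hx : InCorner i j x) (hy : InCorner j k y) :
    InCorner i k (x * y) := by
  constructor
  · rw [← mul_assoc, hx.1]
  · rw [mul_assoc, hy.2]

theorem InCorner.mul_eq_zero {i j k l x y : G} (hx : InCorner i j x) (hy : InCorner k l y)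
    (hjk : j * k = 0) : x * y = 0 := by
  rw [← hx.2, ← hy.1, mul_assoc, ← mul_assoc j, hjk, zero_mul, mul_zero]

theorem InCorner.eq_mul_mul {i j x : G} (hx : InCorner i j x) : i * x * j = x := by
  rw [hx.1, hx.2]

theorem inCorner_C_iff {i j : G} {s : PowerSeries G} :
    InCorner (PowerSeries.C i) (PowerSeries.C j) s ↔
      ∀ n, InCorner i j (PowerSeries.coeff n s) := by
  simp [InCorner, PowerSeries.ext_iff, forall_and]

end Corners

/-! ### Diagonalizing a deformed idempotent by conjugation. -/

section Diagonalization

variable {G : Type*} [Ring G] {e f : G}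

/-- The commutator with `e` acts as `1` on the corner `e G f` and as `-1` on `f G e`, so its square
is the identity on off-diagonal elements. -/
theorem IsPeircePair.lie_lie_of_offDiagonal (h : IsPeircePair e f) {H : G} (he : e * H * e = 0)
    (hf : f * H * f = 0) : e * (e * H - H * e) - (e * H - H * e) * e = H := by
  have h1 : e * (e * H) = e * H * f := by
    rw [← mul_assoc, h.ee]
    calc e * H = e * H * (e + f) := by rw [h.add, mul_one]
      _ = e * H * f := by rw [mul_add, he, zero_add]
  have h2 : H * e * e = f * H * e := by
    rw [mul_assoc, h.ee]
    calc H * e = (e + f) * H * e := by rw [h.add, one_mul]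
      _ = f * H * e := by rw [add_mul, add_mul, he, zero_add]
  rw [mul_sub, sub_mul, h1, h2, ← mul_assoc, he]
  conv_rhs => rw [h.decomp H, he, hf]
  abel

open PowerSeries

/-- A power series with constant coefficient `e` is conjugate to a diagonal one. -/
theorem IsPeircePair.exists_unit_conj_commute (h : IsPeircePair e f) {E : PowerSeries G}
    (hE : coeff 0 E = e) :
    ∃ u : (PowerSeries G)ˣ, coeff 0 (u : PowerSeries G) = 1 ∧
      ((u⁻¹ : (PowerSeries G)ˣ) : PowerSeries G) * E * u * C e = C e * (((u⁻¹ : (PowerSeries G)ˣ) : PowerSeries G) * E * u) := by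
  have hp := h.powerSeries
  let E' : PowerSeries G := PowerSeries.mk fun n => coeff (n + 1) E
  have hEE : E = C e + X * E' := by
    ext n
    cases n with
    | zero => simpa using hE
    | succ n => simp [coeff_succ_X_mul, E']
  clear_value E'
  generalize hε : (C e : PowerSeries G) = ε at *
  generalize hη : (C f : PowerSeries G) = η at *
  -- The unit sought is `1 + w` with `w` off-diagonal and `E * (1 + w) = (1 + w) * (ε + X * d)` with
  -- `d` diagonal. Expanding leaves `ε * w - w * ε = -X * (Y - d - w * d)`. With `d` the diagonal
  -- part of `Y`, the bracket is the off-diagonal series `H`.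
  let Y : PowerSeries G → PowerSeries G := fun w => E' * (1 + w)
  let d : PowerSeries G → PowerSeries G := fun w => ε * Y w * ε + η * Y w * η
  let H : PowerSeries G → PowerSeries G := fun w =>
    (ε * Y w * η + η * Y w * ε) - w * d w
  have hHne : ∀ n x y, AgreeBelow n x y → AgreeBelow n (H x) (H y) := by
    intro n x y hxy
    have hY : AgreeBelow n (Y x) (Y y) := .mul (.refl _ _) (.add (.refl _ _) hxy)
    have key : ∀ a b : PowerSeries G, AgreeBelow n (a * Y x * b) (a * Y y * b) := fun a b =>
      .mul (.mul (.refl _ _) hY) (.refl _ _)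
    exact .sub (.add (key _ _) (key _ _)) (.mul hxy (.add (key _ _) (key _ _)))
  -- Taking the commutator with `ε` is an involution on off-diagonal series, so the equation for `w`
  -- becomes the fixed-point equation `w = X * (H w * ε - ε * H w)`.
  obtain ⟨w, hw⟩ := exists_eq_X_mul (fun w => H w * ε - ε * H w) fun n x y hxy =>
    .sub (.mul (hHne n x y hxy) (.refl _ _)) (.mul (.refl _ _) (hHne n x y hxy))
  have hX : ∀ s : PowerSeries G, s * X = X * s := fun s => (commute_X s).eq
  have hce : ∀ Z : PowerSeries G, ε * (Z * ε - ε * Z) * ε = 0 := fun Z => by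
    rw [mul_sub, sub_mul, ← mul_assoc ε ε, hp.ee, mul_assoc, mul_assoc Z, hp.ee, mul_assoc, sub_self]
  have hcf : ∀ Z : PowerSeries G, η * (Z * ε - ε * Z) * η = 0 := fun Z => by
    rw [mul_sub, sub_mul, ← mul_assoc η ε, hp.fe, mul_assoc, mul_assoc Z, hp.ef]
    simp
  have hwe : ε * w * ε = 0 := by
    rw [hw, ← mul_assoc, hX, mul_assoc X, mul_assoc X, hce, mul_zero]
  have hwf : η * w * η = 0 := by
    rw [hw, ← mul_assoc, hX, mul_assoc X, mul_assoc X, hcf, mul_zero]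
  have hde : ε * d w = d w * ε := by
    simp only [d, mul_add, add_mul, ← mul_assoc, hp.ee, hp.ef, zero_mul, add_zero]
    simp only [mul_assoc, hp.ee, hp.fe, mul_zero, add_zero]
  have hdf : η * d w = d w * η := by
    simp only [d, mul_add, add_mul, ← mul_assoc, hp.ff, hp.fe, zero_mul, zero_add]
    simp only [mul_assoc, hp.ff, hp.ef, mul_zero, zero_add]
  have hHe : ε * H w * ε = 0 := by
    simp only [H, mul_sub, sub_mul, mul_add, add_mul]
    rw [← mul_assoc ε w, mul_assoc (ε * w), ← hde, ← mul_assoc (ε * w), hwe]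
    simp only [← mul_assoc, hp.ef, zero_mul]
    simp only [mul_assoc, hp.fe, mul_zero]
    simp
  have hHf : η * H w * η = 0 := by
    simp only [H, mul_sub, sub_mul, mul_add, add_mul]
    rw [← mul_assoc η w, mul_assoc (η * w), ← hdf, ← mul_assoc (η * w), hwf]
    simp only [← mul_assoc, hp.fe, zero_mul]
    simp only [mul_assoc, hp.ef, mul_zero]
    simp
  have hHH := hp.lie_lie_of_offDiagonal hHe hHf
  have hlie : ε * w - w * ε = - (X * H w) := by
    have hc : ε * w = X * (ε * (H w * ε - ε * H w)) := by
      conv_lhs => rw [hw, ← mul_assoc, hX, mul_assoc]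
    have hc' : w * ε = X * ((H w * ε - ε * H w) * ε) := by
      conv_lhs => rw [hw, mul_assoc]
    rw [hc, hc', ← mul_sub, ← mul_neg]
    congr 1
    conv_rhs => rw [← hHH]
    noncomm_ring
  have hmain : E * (1 + w) = (1 + w) * (ε + X * d w) := by
    have hYd : Y w = d w + (H w + w * d w) := by
      conv_lhs => rw [hp.decomp (Y w)]
      simp only [H, d]
      abel
    have hEw : E * (1 + w) = ε + ε * w + X * Y w := by
      rw [hEE]
      simp only [Y]
      noncomm_ring
    have hwX : (1 + w) * (ε + X * d w) = ε + w * ε + X * d w + X * (w * d w) := by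
      rw [← mul_assoc X w, ← hX w]
      noncomm_ring
    rw [hEw, hwX, hYd, mul_add X (d w) (H w + w * d w), mul_add X (H w), ← sub_eq_zero]
    have : ε * w - w * ε + X * H w = 0 := by rw [hlie, neg_add_cancel]
    rw [← this]
    abel
  have hw0 : coeff 0 w = 0 := by rw [hw, coeff_zero_X_mul]
  have hu : IsUnit (1 + w) := by
    refine MvPowerSeries.isUnit_iff_constantCoeff.2 ?_
    have : MvPowerSeries.constantCoeff (1 + w) = 1 := by
      change PowerSeries.constantCoeff (1 + w) = 1
      rw [← coeff_zero_eq_constantCoeff_apply, map_add, hw0]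
      simp
    rw [this]
    exact isUnit_one
  obtain ⟨u, hu⟩ := hu
  refine ⟨u, by rw [hu, map_add, hw0]; simp, ?_⟩
  rw [mul_assoc (((u⁻¹ : (PowerSeries G)ˣ) : PowerSeries G)), hu, hmain, ← hu,
    Units.inv_mul_cancel_left, add_mul ε (X * d w) ε, mul_add ε ε (X * d w), ← mul_assoc ε X, hX ε,
    mul_assoc X ε, mul_assoc X (d w), hde]

end Diagonalization

/-! ### Lie deformations with diagonal image of `e`. -/

section LieDeformation

open PowerSeries

variable {R G : Type*} [CommRing R] [Ring G] [Algebra R G] {e f : G}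

theorem IsPeircePair.mul_C_of_mul_C (h : IsPeircePair e f) {s : PowerSeries G} (hd : s * C e = C e * s) :
    s * C f = C f * s := by
  have hcf : (C f : PowerSeries G) = 1 - C e := by
    rw [← map_one C, ← h.add, map_add]; abel
  rw [hcf, mul_sub, sub_mul, hd, mul_one, one_mul]

/-- A linear map into power series that is the identity modulo `X` and preserves commutators. -/
structure IsLieDeformation (ψ : G →ₗ[R] PowerSeries G) : Prop where
  coeff_zero : ∀ x, coeff 0 (ψ x) = x
  map_lie : ∀ x y, ψ (x * y - y * x) = ψ x * ψ y - ψ y * ψ x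

namespace IsLieDeformation

variable {ψ : G →ₗ[R] PowerSeries G}

/-- Since `1` is central, `ψ 1` commutes with every `ψ x`; the leading coefficient argument makes
its coefficients central. As `f = 1 - e`, diagonality passes from `ψ e` to `ψ f`. -/
theorem commute_symm (hψ : IsLieDeformation ψ) (h : IsPeircePair e f)
    (hd : ψ e * C e = C e * ψ e) : ψ f * C f = C f * ψ f := by
  have h1 : ψ 1 * C f = C f * ψ 1 := commute_C_iff.2 fun n =>
    coeff_mul_eq_mul_coeff (P := fun _ => True) (φ := ψ) (fun _ _ _ => trivial)
      (fun x _ => hψ.coeff_zero x)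
      (fun x _ => by
        have := hψ.map_lie 1 x
        rw [one_mul, mul_one, sub_self, map_zero] at this
        exact (sub_eq_zero.1 this.symm)) n trivial
  have hf : f = 1 - e := by rw [← h.add]; abel
  have hcf : (C f : PowerSeries G) = 1 - C e := by rw [hf, map_sub, map_one]
  rw [hcf] at h1 ⊢
  rw [hf, map_sub, sub_mul, h1, mul_sub _ (ψ 1)]
  congr 1
  rw [mul_sub, sub_mul, hd, mul_one, one_mul]

/-- From `e * x - x * e = x` comes the Sylvester equation `(ψ e - 1) * ψ x = ψ x * ψ e`. As `ψ e` is
diagonal, `ψ x` minus its `(e, f)` part solves it too, and the constant-term equation is injective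
on elements without `(e, f)` part. -/
theorem inCorner_of_inCorner (hψ : IsLieDeformation ψ) (h : IsPeircePair e f)
    (hfe : ∀ x, InCorner f e x → x + x = 0 → x = 0)
    (hd : ψ e * C e = C e * ψ e) {x : G} (hx : InCorner e f x) :
    InCorner (C e) (C f) (ψ x) := by
  have hp := h.powerSeries
  have hd' := h.mul_C_of_mul_C hd
  have hlie : ψ e * ψ x - ψ x * ψ e = ψ x := by
    rw [← hψ.map_lie, hx.1, ← hx.2, mul_assoc, h.fe, mul_zero, sub_zero]
  have hs : (ψ e - 1) * ψ x = ψ x * ψ e := by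
    rw [sub_mul, one_mul, sub_eq_iff_eq_add, add_comm, ← sub_eq_iff_eq_add, hlie]
  have hzero : ψ x - C e * ψ x * C f = 0 := by
    refine eq_zero_of_mul_eq_mul (P := fun y => e * y * f = 0) (s := ψ e - 1) (u := ψ e)
      (fun n => ?_) (fun y hy hy' => ?_) ?_
    · rw [map_sub, coeff_mul_C, coeff_C_mul, mul_sub, sub_mul, mul_assoc e (coeff n (ψ x)) f,
        ← mul_assoc e e, h.ee, mul_assoc e _ f, mul_assoc (coeff n (ψ x)), h.ff, sub_self]
    · rw [map_sub, hψ.coeff_zero] at hy'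
      have he1 : e - coeff 0 (1 : PowerSeries G) = -f := by
        rw [coeff_zero_one, ← h.add]; abel
      rw [he1] at hy'
      have h1 : f * y * f = 0 := by
        have := congrArg (· * f) hy'
        simpa [mul_assoc, h.ef] using this
      have h2 : e * y * e = 0 := by
        have := congrArg (e * ·) hy'
        simpa [← mul_assoc, h.ef] using this.symm
      -- The equation reads `-f * y = y * e`; its `(f, e)` part says that `f * y * e` is its own
      -- negative, so torsion in the opposite corner is what matters.
      have h3 : f * y * e = 0 := by
        refine hfe _ (inCorner_mul_mul h.ff h.ee y) ?_
        have := congrArg (fun z => f * z * e) hy'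
        simp only [neg_mul, mul_neg, ← mul_assoc, h.ff] at this
        rw [mul_assoc (f * y), h.ee] at this
        nth_rw 1 [← this]
        exact neg_add_cancel _
      rw [h.decomp y, h1, h2, h3, hy]
      simp
    · rw [mul_sub (ψ e - 1), sub_mul (ψ x), hs]
      congr 1
      have hc : (ψ e - 1) * C e = C e * (ψ e - 1) := by
        rw [sub_mul, mul_sub, hd, one_mul, mul_one]
      rw [← mul_assoc, ← mul_assoc, hc, mul_assoc (C e), hs, mul_assoc _ (C f), ← hd']
      simp only [mul_assoc]
  rw [sub_eq_zero.1 hzero]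
  exact inCorner_mul_mul hp.ee hp.ff _

/-- The off-diagonal part of `ψ x` commutes with the diagonal series `ψ e`, whose constant term `e`
commutes with no nonzero off-diagonal element. -/
theorem commute_of_commute (hψ : IsLieDeformation ψ) (h : IsPeircePair e f)
    (hd : ψ e * C e = C e * ψ e) {x : G} (hx : e * x = x * e) :
    ψ x * C e = C e * ψ x := by
  have hp := h.powerSeries
  have hd' := h.mul_C_of_mul_C hd
  have hlie : ψ e * ψ x = ψ x * ψ e := by
    rw [← sub_eq_zero, ← hψ.map_lie, hx, sub_self, map_zero]
  have hzero : C e * ψ x * C f + C f * ψ x * C e = 0 := by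
    refine eq_zero_of_mul_eq_mul (P := fun y => e * y * e = 0 ∧ f * y * f = 0) (s := ψ e)
      (u := ψ e) (fun n => ?_) (fun y hy hy' => ?_) ?_
    · simp only [map_add, coeff_mul_C, coeff_C_mul, mul_add, add_mul]
      constructor
      · simp only [mul_assoc, h.fe, mul_zero, zero_add]
        simp only [← mul_assoc, h.ef, zero_mul]
      · simp only [mul_assoc, h.ef, mul_zero, add_zero]
        simp only [← mul_assoc, h.fe, zero_mul]
    · rw [hψ.coeff_zero] at hy'
      rw [h.decomp y, hy.1, hy.2, hy', mul_assoc y, h.ef, mul_assoc f, ← hy', ← mul_assoc, h.fe]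
      simp
    · have key : ∀ a b : PowerSeries G, ψ e * a = a * ψ e → ψ e * b = b * ψ e →
          ψ e * (a * ψ x * b) = a * ψ x * b * ψ e := fun a b ha hb => by
        rw [← mul_assoc, ← mul_assoc, ha, mul_assoc a, hlie, mul_assoc _ b, ← hb]
        simp only [mul_assoc]
      rw [mul_add, add_mul, key _ _ hd hd', key _ _ hd' hd]
  have h1 : C e * ψ x * C f = 0 := by
    have := congrArg (C e * ·) hzero
    simpa [mul_add, ← mul_assoc, hp.ee, hp.ef, -map_mul] using this
  have h2 : C f * ψ x * C e = 0 := by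
    rwa [h1, zero_add] at hzero
  calc ψ x * C e = (C e + C f) * ψ x * C e := by rw [hp.add, one_mul]
    _ = C e * ψ x * (C e + C f) := by
      rw [add_mul, add_mul, mul_add, h1, h2]
    _ = C e * ψ x := by rw [hp.add, mul_one]

end IsLieDeformation

end LieDeformation

/-! ### Removing central parts from the diagonal corners. -/

section CentralCorrection

open PowerSeries

variable {R G : Type*} [CommRing R] [Ring G] [Algebra R G] {e f : G}

/-- A linear map into power series that is the identity modulo `X`, preserves the corners of the
Peirce decomposition, and preserves commutators modulo the center. -/
structure IsPeirceDeformation (e f : G) (D : G →ₗ[R] PowerSeries G) : Prop where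
  coeff_zero : ∀ x, coeff 0 (D x) = x
  ee : ∀ x, InCorner e e x → InCorner (C e) (C e) (D x)
  ef : ∀ x, InCorner e f x → InCorner (C e) (C f) (D x)
  fe : ∀ x, InCorner f e x → InCorner (C f) (C e) (D x)
  ff : ∀ x, InCorner f f x → InCorner (C f) (C f) (D x)
  commute : ∀ x y, x * y = y * x → D x * D y = D y * D x
  lie : ∀ x y n, coeff n (D x * D y - D y * D x - D (x * y - y * x)) ∈ Set.center G

/-- Every central element of the corner of the idempotent `f` lifts uniquely to a central element
of the whole ring. -/
structure HasCentralLifts (f : G) : Prop where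
  exists_lift : ∀ b, InCorner f f b → (∀ b', InCorner f f b' → b * b' = b' * b) →
    ∃ z ∈ Set.center G, f * z = b
  eq_zero : ∀ z ∈ Set.center G, f * z = 0 → z = 0

theorem HasCentralLifts.series_eq_zero (hf : HasCentralLifts f) {s : PowerSeries G}
    (hs : ∀ n, coeff n s ∈ Set.center G) (h : C f * s = 0) : s = 0 := by
  ext n
  rw [map_zero]
  refine hf.eq_zero _ (hs n) ?_
  rw [← coeff_C_mul, h, map_zero]

/-- Lifts are chosen coefficient by coefficient; their uniqueness makes the choice linear. -/
theorem HasCentralLifts.exists_linear_lift (hf : HasCentralLifts f) (Q : G →ₗ[R] PowerSeries G)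
    (hQ : ∀ x n, ∃ z ∈ Set.center G, f * z = coeff n (Q x)) :
    ∃ τ : G →ₗ[R] PowerSeries G, (∀ x n, coeff n (τ x) ∈ Set.center G) ∧
      ∀ x, C f * τ x = Q x := by
  choose z hz hfz using hQ
  have hC : ∀ x, C f * PowerSeries.mk (z x) = Q x := fun x => by
    ext n; rw [coeff_C_mul, coeff_mk, hfz]
  refine ⟨⟨⟨fun x => PowerSeries.mk (z x), fun x y => ?_⟩, fun r x => ?_⟩, fun x n => ?_, hC⟩
  · rw [← sub_eq_zero]
    refine hf.series_eq_zero (fun n => ?_) ?_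
    · simp only [map_sub, map_add, coeff_mk]
      exact (Subring.center G).sub_mem (hz _ _) ((Subring.center G).add_mem (hz _ _) (hz _ _))
    · rw [mul_sub, mul_add, hC, hC, hC, map_add, sub_self]
  · rw [← sub_eq_zero]
    refine hf.series_eq_zero (fun n => ?_) ?_
    · rw [map_sub, RingHom.id_apply, coeff_smul_of_module]
      change coeff n (PowerSeries.mk (z (r • x))) - r • coeff n (PowerSeries.mk (z x)) ∈
        Subalgebra.center R G
      rw [coeff_mk, coeff_mk]
      exact (Subalgebra.center R G).sub_mem (hz _ _) ((Subalgebra.center R G).smul_mem (hz _ _) r)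
    · rw [mul_sub, RingHom.id_apply, mul_smul_comm, hC, hC, map_smul, sub_self]
  · simpa using hz x n

variable {ψ : G →ₗ[R] PowerSeries G}

/-- Elements of `e G e` commute with those of `f G f`, hence so do their images. As `b` runs over `f
G f`, the series `C f * ψ b` has constant term `b`, so the coefficients of `C f * ψ (e * x * e)` are
central in `f G f`. -/
theorem IsLieDeformation.exists_central_lift (hψ : IsLieDeformation ψ) (h : IsPeircePair e f)
    (hd : ψ e * C e = C e * ψ e) (hf : HasCentralLifts f) :
    ∃ τ : G →ₗ[R] PowerSeries G, (∀ x n, coeff n (τ x) ∈ Set.center G) ∧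
      ∀ x, C f * τ x = C f * ψ (e * x * e) := by
  have hp := h.powerSeries
  have hdf := hψ.commute_symm h hd
  have hcomm : ∀ x, e * x = x * e → ψ x * C f = C f * ψ x := fun x hx =>
    h.mul_C_of_mul_C (hψ.commute_of_commute h hd hx)
  have hcommf : ∀ x, InCorner f f x → ψ x * C f = C f * ψ x := fun x hx =>
    hψ.commute_of_commute h.symm hdf (by rw [hx.1, hx.2])
  have hcorner : ∀ s : PowerSeries G, s * C f = C f * s → InCorner (C f) (C f) (C f * s) :=
    fun s hs => ⟨by rw [← mul_assoc, hp.ff], by rw [mul_assoc, hs, ← mul_assoc, hp.ff]⟩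
  refine hf.exists_linear_lift (LinearMap.mulLeft R (C f) ∘ₗ ψ ∘ₗ LinearMap.mulRight R e ∘ₗ
    LinearMap.mulLeft R e) fun x n => ?_
  simp only [LinearMap.comp_apply, LinearMap.mulLeft_apply, LinearMap.mulRight_apply]
  have hx := inCorner_mul_mul h.ee h.ee x
  generalize e * x * e = a at hx
  have ha := hcomm a (by rw [hx.1, hx.2])
  refine hf.exists_lift _ (inCorner_C_iff.1 (hcorner _ ha) n) fun b hb => ?_
  refine coeff_mul_eq_mul_coeff (P := InCorner f f) (φ := fun b => C f * ψ b)
    (fun n y hy => inCorner_C_iff.1 (hcorner _ (hcommf y hy)) n)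
    (fun y hy => ?_) (fun y hy => ?_) n hb
  · rw [coeff_C_mul, hψ.coeff_zero, hy.1]
  · have hab : ψ a * ψ y = ψ y * ψ a := by
      rw [← sub_eq_zero, ← hψ.map_lie, hx.mul_eq_zero hy h.ef, hy.mul_eq_zero hx h.fe, sub_self,
        map_zero]
    rw [mul_assoc, ← mul_assoc (ψ a), ha, mul_assoc (C f), hab, mul_assoc, ← mul_assoc (ψ y),
      hcommf y hy, mul_assoc (C f)]

/-- With `τ` correcting the images of `e G e` and `σ` those of `f G f`, the map is `D = ψ - τ - σ`.
Central corrections do not change commutators of images. -/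
theorem IsLieDeformation.exists_isPeirceDeformation (hψ : IsLieDeformation ψ)
    (h : IsPeircePair e f) (hef : ∀ x, InCorner e f x → x + x = 0 → x = 0)
    (hfe : ∀ x, InCorner f e x → x + x = 0 → x = 0)
    (hd : ψ e * C e = C e * ψ e) (he : HasCentralLifts e) (hf : HasCentralLifts f) :
    ∃ D : G →ₗ[R] PowerSeries G, IsPeirceDeformation e f D ∧
      (∀ x n, coeff n (ψ x - D x) ∈ Set.center G) := by
  have hp := h.powerSeries
  have hdf := hψ.commute_symm h hd
  obtain ⟨τ, hτ, hfτ⟩ := hψ.exists_central_lift h hd hf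
  obtain ⟨σ, hσ, heσ⟩ := hψ.exists_central_lift h.symm hdf he
  have hτ0 : ∀ x, e * x * e = 0 → τ x = 0 := fun x hx =>
    hf.series_eq_zero (hτ x) (by rw [hfτ, hx, map_zero, mul_zero])
  have hσ0 : ∀ x, f * x * f = 0 → σ x = 0 := fun x hx =>
    he.series_eq_zero (hσ x) (by rw [heσ, hx, map_zero, mul_zero])
  have hcτ := fun x => commute_of_coeff_mem_center (hτ x)
  have hcσ := fun x => commute_of_coeff_mem_center (hσ x)
  have hcorner : ∀ {i j : G} {s : PowerSeries G}, C i + C j = (1 : PowerSeries G) →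
      s * C i = C i * s → C j * s = 0 → InCorner (C i) (C i) s := by
    intro i j s hij hs hjs
    have : C i * s = s := by
      rw [eq_sub_of_add_eq hij, sub_mul, hjs, one_mul, sub_zero]
    exact ⟨this, hs.trans this⟩
  have hcenter : ∀ x n, coeff n (τ x + σ x) ∈ Set.center G := fun x n => by
    rw [map_add]
    exact (Subring.center G).add_mem (hτ x n) (hσ x n)
  have key : ∀ a b s t : PowerSeries G, (∀ c, s * c = c * s) → (∀ c, t * c = c * t) →
      (a - s) * (b - t) - (b - t) * (a - s) = a * b - b * a := by
    intro a b s t hs ht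
    rw [sub_mul, sub_mul, mul_sub, mul_sub, mul_sub, mul_sub, hs b, ht a, hs t]
    abel
  have hc := fun x => commute_of_coeff_mem_center (hcenter x)
  have hD : ∀ x, (ψ - τ - σ) x = ψ x - (τ x + σ x) := fun x => by
    rw [LinearMap.sub_apply, LinearMap.sub_apply, sub_sub]
  have hlie : ∀ x y, (ψ - τ - σ) x * (ψ - τ - σ) y - (ψ - τ - σ) y * (ψ - τ - σ) x =
      ψ x * ψ y - ψ y * ψ x := fun x y => by
    rw [hD x, hD y, key _ _ _ _ (hc x) (hc y)]
  refine ⟨ψ - τ - σ, ⟨fun x => ?_, fun x hx => ?_, fun x hx => ?_, fun x hx => ?_, fun x hx => ?_,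
    fun x y hx => ?_, fun x y n => ?_⟩, fun x n => ?_⟩
  -- The constant term of `C f * τ x` is `f * (e * x * e) = 0`, and a central element killed by `f`
  -- vanishes.
  · have h1 : coeff 0 (τ x) = 0 := hf.eq_zero _ (hτ x 0) (by
      rw [← coeff_C_mul, hfτ, coeff_C_mul, hψ.coeff_zero, ← mul_assoc, ← mul_assoc, h.fe]; simp)
    have h2 : coeff 0 (σ x) = 0 := he.eq_zero _ (hσ x 0) (by
      rw [← coeff_C_mul, heσ, coeff_C_mul, hψ.coeff_zero, ← mul_assoc, ← mul_assoc, h.ef]; simp)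
    simp [h1, h2, hψ.coeff_zero, -coeff_zero_eq_constantCoeff]
  · simp only [LinearMap.sub_apply]
    rw [hσ0 x (by rw [← hx.1, ← mul_assoc, h.fe]; simp), sub_zero]
    refine hcorner hp.add ?_ ?_
    · rw [sub_mul, mul_sub, hcτ, hψ.commute_of_commute h hd (by rw [hx.1, hx.2])]
    · rw [mul_sub, hfτ, hx.eq_mul_mul, sub_self]
  · simp only [LinearMap.sub_apply]
    rw [hτ0 x (by rw [mul_assoc, ← hx.2, mul_assoc, h.fe]; simp),
      hσ0 x (by rw [← hx.1, ← mul_assoc, h.fe]; simp), sub_zero, sub_zero]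
    exact hψ.inCorner_of_inCorner h hfe hd hx
  · simp only [LinearMap.sub_apply]
    rw [hτ0 x (by rw [← hx.1, ← mul_assoc, h.ef]; simp),
      hσ0 x (by rw [mul_assoc, ← hx.2, mul_assoc, h.ef]; simp), sub_zero, sub_zero]
    exact hψ.inCorner_of_inCorner h.symm hef hdf hx
  · simp only [LinearMap.sub_apply]
    rw [hτ0 x (by rw [← hx.1, ← mul_assoc, h.ef]; simp), sub_zero]
    refine hcorner hp.symm.add ?_ ?_
    · rw [sub_mul, mul_sub, hcσ, hψ.commute_of_commute h.symm hdf (by rw [hx.1, hx.2])]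
    · rw [mul_sub, heσ, hx.eq_mul_mul, sub_self]
  · rw [← sub_eq_zero, hlie, ← hψ.map_lie, hx, sub_self, map_zero]
  · rw [hlie, ← hψ.map_lie, hD (x * y - y * x), sub_sub_cancel]
    exact hcenter _ n
  · simp only [LinearMap.sub_apply, sub_sub, sub_sub_cancel]
    exact hcenter x n

end CentralCorrection

/-! ### Multiplicativity of the corrected map. -/

section Multiplicativity

open PowerSeries

variable {R G : Type*} [CommRing R] [Ring G] [Algebra R G] {e f : G}

/-- Elements of the corner of `e` are determined by their action on the off-diagonal corners. -/
def IsFaithfulCorner (e f : G) : Prop :=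
  ∀ a, InCorner e e a → (∀ m, InCorner e f m → a * m = 0) → (∀ n, InCorner f e n → n * a = 0) →
    a = 0

/-- No nonzero central element generates a central ideal in the corner of `e`. -/
def NoCentralMultiples (e : G) : Prop :=
  ∀ z ∈ Set.center G, (∀ a, InCorner e e a → ∀ y, InCorner e e y → a * z * y = y * (a * z)) → z = 0

/-- A nonzero central element annihilates off-diagonal `m` and `n` only if `m * n = n * m = 0`. -/
def HasTrivialAnnihilators (e f : G) : Prop :=
  ∀ z ∈ Set.center G, ∀ m n, InCorner e f m → InCorner f e n → z * m = 0 → z * n = 0 →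
    z = 0 ∨ (m * n = 0 ∧ n * m = 0)

theorem IsPeircePair.series_eq_zero_of_inCorner (h : IsPeircePair e f) {s : PowerSeries G}
    (hs : ∀ n, coeff n s ∈ Set.center G) (hc : InCorner (C e) (C f) s) : s = 0 := by
  rw [← hc.2, commute_of_coeff_mem_center hs, ← hc.1, ← mul_assoc, h.powerSeries.fe, zero_mul]

namespace IsPeirceDeformation

variable {D : G →ₗ[R] PowerSeries G}

theorem symm (hD : IsPeirceDeformation e f D) : IsPeirceDeformation f e D :=
  ⟨hD.coeff_zero, hD.ff, hD.fe, hD.ef, hD.ee, hD.commute, hD.lie⟩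

/-- Here `m * a = 0`, so the product is a commutator. The error is central and lies in an
off-diagonal corner, hence is zero. -/
theorem map_mul_ee_ef (hD : IsPeirceDeformation e f D) (h : IsPeircePair e f) {a m : G}
    (ha : InCorner e e a) (hm : InCorner e f m) : D (a * m) = D a * D m := by
  have hl := hD.lie a m
  rw [hm.mul_eq_zero ha h.fe, (hD.ef m hm).mul_eq_zero (hD.ee a ha) h.powerSeries.fe, sub_zero,
    sub_zero] at hl
  exact (sub_eq_zero.1 (h.series_eq_zero_of_inCorner hl
    (((hD.ee a ha).mul (hD.ef m hm)).sub (hD.ef _ (ha.mul hm))))).symm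

theorem map_mul_ef_ff (hD : IsPeirceDeformation e f D) (h : IsPeircePair e f) {m b : G}
    (hm : InCorner e f m) (hb : InCorner f f b) : D (m * b) = D m * D b := by
  have hl := hD.lie m b
  rw [hb.mul_eq_zero hm h.fe, (hD.ff b hb).mul_eq_zero (hD.ef m hm) h.powerSeries.fe, sub_zero,
    sub_zero] at hl
  exact (sub_eq_zero.1 (h.series_eq_zero_of_inCorner hl
    (((hD.ef m hm).mul (hD.ff b hb)).sub (hD.ef _ (hm.mul hb))))).symm

/-- By associativity the difference annihilates `D m` and `D n` for off-diagonal `m`, `n`. The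
leading coefficient argument turns this into annihilation of `m` and `n` by each coefficient, where
faithfulness applies. -/
theorem map_mul_ee_ee (hD : IsPeirceDeformation e f D) (h : IsPeircePair e f)
    (hw : IsFaithfulCorner e f) {a a' : G} (ha : InCorner e e a) (ha' : InCorner e e a') :
    D (a * a') = D a * D a' := by
  rw [← sub_eq_zero]
  have hc : InCorner (C e) (C e) (D (a * a') - D a * D a') :=
    (hD.ee _ (ha.mul ha')).sub ((hD.ee a ha).mul (hD.ee a' ha'))
  ext n
  rw [map_zero]
  refine hw _ (inCorner_C_iff.1 hc n) (fun m hm => ?_) (fun m hm => ?_)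
  · refine coeff_mul_eq_zero (P := InCorner e f) (φ := D)
      (fun n x hx => inCorner_C_iff.1 (hD.ef x hx) n) (fun x _ => hD.coeff_zero x)
      (fun x hx => ?_) n hm
    rw [sub_mul, ← hD.map_mul_ee_ef h (ha.mul ha') hx, mul_assoc (D a),
      ← hD.map_mul_ee_ef h ha' hx, ← hD.map_mul_ee_ef h ha (ha'.mul hx), mul_assoc, sub_self]
  · refine mul_coeff_eq_zero (P := InCorner f e) (φ := D)
      (fun n x hx => inCorner_C_iff.1 (hD.fe x hx) n) (fun x _ => hD.coeff_zero x)
      (fun x hx => ?_) n hm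
    rw [mul_sub, ← hD.symm.map_mul_ef_ff h.symm hx (ha.mul ha'), ← mul_assoc (D x),
      ← hD.symm.map_mul_ef_ff h.symm hx ha, ← hD.symm.map_mul_ef_ff h.symm (hx.mul ha) ha',
      mul_assoc, sub_self]

/-- The deviation of `D` from preserving a commutator. -/
noncomputable def lieDefect (D : G →ₗ[R] PowerSeries G) (x y : G) : PowerSeries G :=
  D x * D y - D y * D x - D (x * y - y * x)

theorem lieDefect_swap (D : G →ₗ[R] PowerSeries G) (x y : G) :
    lieDefect D x y = - lieDefect D y x := by
  simp only [lieDefect, map_sub]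
  abel

theorem C_mul_lieDefect (hD : IsPeirceDeformation e f D) (h : IsPeircePair e f) {m n : G}
    (hm : InCorner e f m) (hn : InCorner f e n) :
    C e * lieDefect D m n = D m * D n - D (m * n) := by
  have hp := h.powerSeries
  have h1 : C e * (D n * D m) = 0 := by
    rw [← ((hD.fe n hn).mul (hD.ef m hm)).1, ← mul_assoc, hp.ef, zero_mul]
  have h2 : C e * D (n * m) = 0 := by
    rw [← (hD.ff _ (hn.mul hm)).1, ← mul_assoc, hp.ef, zero_mul]
  rw [lieDefect, map_sub, mul_sub, mul_sub, mul_sub, h1, h2, ((hD.ef m hm).mul (hD.fe n hn)).1,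
    (hD.ee _ (hm.mul hn)).1, sub_zero, sub_zero]

/-- The central defect can be multiplied with `D m` through its `e` part on the left or its `f` part
on the right. The results are `±(D m * D n * D m - D (m * n * m))`, so twice the product vanishes.
-/
theorem lieDefect_mul_left (hD : IsPeirceDeformation e f D) (h : IsPeircePair e f)
    (hef : ∀ x, InCorner e f x → x + x = 0 → x = 0) {m n : G}
    (hm : InCorner e f m) (hn : InCorner f e n) : lieDefect D m n * D m = 0 := by
  have hDm := hD.ef m hm
  have hc : ∀ t, lieDefect D m n * t = t * lieDefect D m n :=
    commute_of_coeff_mem_center (hD.lie m n)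
  have h1 : lieDefect D m n * D m = (D m * D n - D (m * n)) * D m := by
    rw [← hD.C_mul_lieDefect h hm hn, ← hc, mul_assoc, hDm.1]
  have h2 : lieDefect D m n * D m = D m * -(D n * D m - D (n * m)) := by
    rw [← hD.symm.C_mul_lieDefect h.symm hn hm, lieDefect_swap D n m, mul_neg, mul_neg, mul_neg,
      neg_neg, ← mul_assoc, hDm.2, hc]
  have hsum : lieDefect D m n * D m + lieDefect D m n * D m = 0 := by
    nth_rw 2 [h2]
    rw [h1, sub_mul, ← hD.map_mul_ee_ef h (hm.mul hn) hm, mul_neg, mul_sub,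
      ← hD.map_mul_ef_ff h hm (hn.mul hm)]
    simp only [mul_assoc]
    abel
  have hcorner : InCorner (C e) (C f) (lieDefect D m n * D m) :=
    ⟨by rw [← mul_assoc, ← hc, mul_assoc, hDm.1], by rw [mul_assoc, hDm.2]⟩
  ext k
  rw [map_zero]
  exact hef _ (inCorner_C_iff.1 hcorner k) (by rw [← map_add, hsum, map_zero])

theorem lieDefect_mul_right (hD : IsPeirceDeformation e f D) (h : IsPeircePair e f)
    (hfe : ∀ x, InCorner f e x → x + x = 0 → x = 0) {m n : G}
    (hm : InCorner e f m) (hn : InCorner f e n) : lieDefect D m n * D n = 0 := by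
  rw [lieDefect_swap, neg_mul, hD.symm.lieDefect_mul_left h.symm hfe hn hm, neg_zero]

theorem lieDefect_eq_zero_of_hasTrivialAnnihilators (hD : IsPeirceDeformation e f D)
    (h : IsPeircePair e f) (hef : ∀ x, InCorner e f x → x + x = 0 → x = 0)
    (hfe : ∀ x, InCorner f e x → x + x = 0 → x = 0) (hQ : HasTrivialAnnihilators e f) {m n : G}
    (hm : InCorner e f m) (hn : InCorner f e n) : lieDefect D m n = 0 := by
  -- If both products vanish, then `m` and `n` commute and so do their images. Otherwise the lowest
  -- coefficient of the defect annihilates `m` and `n`, hence is zero.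
  by_cases hmn : m * n = 0 ∧ n * m = 0
  · rw [lieDefect, hD.commute m n (hmn.1.trans hmn.2.symm), hmn.1, hmn.2]
    simp
  ext k
  rw [map_zero]
  induction k using Nat.strong_induction_on with
  | _ k ih =>
    refine (hQ _ (hD.lie m n k) m n hm hn ?_ ?_).resolve_right hmn
    · have := coeff_mul_of_forall_lt (t := D m) ih
      rw [hD.lieDefect_mul_left h hef hm hn, map_zero, hD.coeff_zero] at this
      exact this.symm
    · have := coeff_mul_of_forall_lt (t := D n) ih
      rw [hD.lieDefect_mul_right h hfe hm hn, map_zero, hD.coeff_zero] at this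
      exact this.symm

theorem lieDefect_eq_zero_of_noCentralMultiples (hD : IsPeirceDeformation e f D)
    (h : IsPeircePair e f) (hw : IsFaithfulCorner e f) (hQ : NoCentralMultiples e) {m n : G}
    (hm : InCorner e f m) (hn : InCorner f e n) : lieDefect D m n = 0 := by
  have hc : ∀ m n t, lieDefect D m n * t = t * lieDefect D m n := fun m n =>
    commute_of_coeff_mem_center (hD.lie m n)
  -- Multiplying the defect of `(m, n)` by `D a` gives the `e` part of the defect of `(a * m, n)`,
  -- so it remains central in the corner.
  have hmul : ∀ {a m n : G}, InCorner e e a → InCorner e f m → InCorner f e n →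
      C e * lieDefect D (a * m) n = lieDefect D m n * D a := by
    intro a m n ha hm hn
    rw [hD.C_mul_lieDefect h (ha.mul hm) hn, hD.map_mul_ee_ef h ha hm, mul_assoc a,
      hD.map_mul_ee_ee h hw ha (hm.mul hn), mul_assoc, ← mul_sub, ← hD.C_mul_lieDefect h hm hn,
      ← mul_assoc, (hD.ee a ha).2, hc]
  ext k
  rw [map_zero]
  induction k using Nat.strong_induction_on generalizing m with
  | _ k ih =>
    refine hQ _ (hD.lie m n k) fun a ha y hy => ?_
    -- With lower coefficients zero, degree `k` shows that the lowest coefficient times `a` is `e`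
    -- times a central element. The multiples of that coefficient are therefore central in `e G e`.
    have hk := congrArg (coeff k) (hmul ha hm hn)
    rw [coeff_C_mul, coeff_mul_of_forall_lt fun j hj => ih j hj hm, hD.coeff_zero] at hk
    have hz : ∀ m t, coeff k (lieDefect D m n) * t = t * coeff k (lieDefect D m n) := fun m =>
      (Set.mem_center_iff.1 (hD.lie m n k)).comm
    rw [← hz m a, ← hk, ← mul_assoc y, hy.2, ← hz _ e, mul_assoc, hy.1, hz _ y]

theorem map_mul_ef_fe (hD : IsPeirceDeformation e f D) (h : IsPeircePair e f) {m n : G}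
    (hm : InCorner e f m) (hn : InCorner f e n) (h0 : lieDefect D m n = 0) :
    D (m * n) = D m * D n := by
  rw [eq_comm, ← sub_eq_zero, ← hD.C_mul_lieDefect h hm hn, h0, mul_zero]

theorem map_mul (hD : IsPeirceDeformation e f D) (h : IsPeircePair e f)
    (hef : ∀ x, InCorner e f x → x + x = 0 → x = 0)
    (hfe : ∀ x, InCorner f e x → x + x = 0 → x = 0) (he : IsFaithfulCorner e f)
    (hf : IsFaithfulCorner f e)
    (hQ : NoCentralMultiples e ∨ NoCentralMultiples f ∨ HasTrivialAnnihilators e f) (x y : G) :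
    D (x * y) = D x * D y := by
  have hdef : ∀ {m n}, InCorner e f m → InCorner f e n → lieDefect D m n = 0 := by
    intro m n hm hn
    rcases hQ with hQ | hQ | hQ
    · exact hD.lieDefect_eq_zero_of_noCentralMultiples h he hQ hm hn
    · rw [lieDefect_swap, hD.symm.lieDefect_eq_zero_of_noCentralMultiples h.symm hf hQ hn hm,
        neg_zero]
    · exact hD.lieDefect_eq_zero_of_hasTrivialAnnihilators h hef hfe hQ hm hn
  have hzero : ∀ {i j k l x y : G}, InCorner i j x → InCorner k l y → j * k = 0 →
      InCorner (C i) (C j) (D x) → InCorner (C k) (C l) (D y) → D (x * y) = D x * D y := by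
    intro i j k l x y hx hy hjk hDx hDy
    rw [hx.mul_eq_zero hy hjk, hDx.mul_eq_zero hDy (by rw [← _root_.map_mul, hjk, map_zero]),
      map_zero]
  refine h.induction (P := fun x => ∀ y, D (x * y) = D x * D y)
    (fun x x' hx hx' y => by rw [add_mul, map_add, map_add, add_mul, hx, hx']) ?_ ?_ ?_ ?_ x y <;>
  intro x hx <;>
  refine h.induction (fun y y' hy hy' => by rw [mul_add, map_add, map_add, mul_add, hy, hy'])
    ?_ ?_ ?_ ?_ <;> intro y hy
  · exact hD.map_mul_ee_ee h he hx hy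
  · exact hD.map_mul_ee_ef h hx hy
  · exact hzero hx hy h.ef (hD.ee x hx) (hD.fe y hy)
  · exact hzero hx hy h.ef (hD.ee x hx) (hD.ff y hy)
  · exact hzero hx hy h.fe (hD.ef x hx) (hD.ee y hy)
  · exact hzero hx hy h.fe (hD.ef x hx) (hD.ef y hy)
  · exact hD.map_mul_ef_fe h hx hy (hdef hx hy)
  · exact hD.map_mul_ef_ff h hx hy
  · exact hD.symm.map_mul_ef_ff h.symm hx hy
  · exact hD.symm.map_mul_ef_fe h.symm hx hy (by rw [lieDefect_swap, hdef hy hx, neg_zero])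
  · exact hzero hx hy h.ef (hD.fe x hx) (hD.fe y hy)
  · exact hzero hx hy h.ef (hD.fe x hx) (hD.ff y hy)
  · exact hzero hx hy h.fe (hD.ff x hx) (hD.ee y hy)
  · exact hzero hx hy h.fe (hD.ff x hx) (hD.ef y hy)
  · exact hD.symm.map_mul_ee_ef h.symm hx hy
  · exact hD.symm.map_mul_ee_ee h.symm hf hx hy

end IsPeirceDeformation

end Multiplicativity

/-! ### Generating series and conjugation back. -/

section LieHigherDerivation

open PowerSeries

variable {R G : Type*} [CommRing R] [Ring G] [Algebra R G] {e f : G}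

/-- The coefficients of a linear map into power series. -/
noncomputable def coeffMap (φ : G →ₗ[R] PowerSeries G) (k : ℕ) : G →ₗ[R] G where
  toFun x := coeff k (φ x)
  map_add' x y := by rw [map_add, map_add]
  map_smul' r x := by rw [map_smul, coeff_smul_of_module, RingHom.id_apply]

/-- The generating power series of a sequence of linear maps. -/
noncomputable def generatingMap (L : ℕ → G →ₗ[R] G) : G →ₗ[R] PowerSeries G where
  toFun x := PowerSeries.mk fun k => L k x
  map_add' x y := by ext k; simp
  map_smul' r x := by
    ext k
    rw [coeff_mk, RingHom.id_apply, coeff_smul_of_module, coeff_mk, map_smul]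

theorem coeff_generatingMap (L : ℕ → G →ₗ[R] G) (k : ℕ) (x : G) :
    coeff k (generatingMap L x) = L k x :=
  coeff_mk k fun k => L k x

theorem IsLieHigherDerivation.isLieDeformation {L : ℕ → G →ₗ[R] G}
    (hL : IsLieHigherDerivation R G L) : IsLieDeformation (generatingMap L) where
  coeff_zero x := by rw [coeff_generatingMap, hL.zero, LinearMap.id_apply]
  map_lie x y := by
    ext n
    rw [coeff_mul_sub_mul, coeff_generatingMap, ← Ring.lie_def, hL.map_lie]
    simp only [coeff_generatingMap, Ring.lie_def]

theorem isHigherDerivation_coeffMap {D : G →ₗ[R] PowerSeries G} (h0 : ∀ x, coeff 0 (D x) = x)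
    (hmul : ∀ x y, D (x * y) = D x * D y) : IsHigherDerivation R G (coeffMap D) where
  zero := LinearMap.ext h0
  map_mul k x y := by
    change coeff k (D (x * y)) = _
    rw [hmul, coeff_mul]
    rfl

/-- Conjugation of a linear map into power series by a unit. -/
noncomputable def conjMap (u : (PowerSeries G)ˣ) (φ : G →ₗ[R] PowerSeries G) :
    G →ₗ[R] PowerSeries G :=
  LinearMap.mulRight R (u : PowerSeries G) ∘ₗ
    LinearMap.mulLeft R ((u⁻¹ : (PowerSeries G)ˣ) : PowerSeries G) ∘ₗ φ

theorem conjMap_apply (u : (PowerSeries G)ˣ) (φ : G →ₗ[R] PowerSeries G) (x : G) :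
    conjMap u φ x = ((u⁻¹ : (PowerSeries G)ˣ) : PowerSeries G) * φ x * u := rfl

theorem conjMap_apply_mul (u : (PowerSeries G)ˣ) (φ : G →ₗ[R] PowerSeries G) (x y : G) :
    conjMap u φ x * conjMap u φ y =
      ((u⁻¹ : (PowerSeries G)ˣ) : PowerSeries G) * (φ x * φ y) * u := by
  simp only [conjMap_apply, mul_assoc, Units.mul_inv_cancel_left]

theorem coeff_zero_conjMap {u : (PowerSeries G)ˣ} (hu : coeff 0 (u : PowerSeries G) = 1)
    {φ : G →ₗ[R] PowerSeries G} (hφ : ∀ x, coeff 0 (φ x) = x) (x : G) :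
    coeff 0 (conjMap u φ x) = x := by
  rw [conjMap_apply, coeff_zero_mul, coeff_zero_mul, hu, coeff_zero_units_inv hu, hφ, one_mul, mul_one]

theorem IsLieDeformation.conj {φ : G →ₗ[R] PowerSeries G} (hφ : IsLieDeformation φ)
    {u : (PowerSeries G)ˣ} (hu : coeff 0 (u : PowerSeries G) = 1) :
    IsLieDeformation (conjMap u φ) where
  coeff_zero := coeff_zero_conjMap hu hφ.coeff_zero
  map_lie x y := by
    rw [conjMap_apply_mul, conjMap_apply_mul, conjMap_apply, hφ.map_lie, mul_sub, sub_mul]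

/-- The Lie higher derivation property from a Peirce decomposition. -/
theorem IsPeircePair.hasLHDProperty (h : IsPeircePair e f)
    (hef : ∀ x, InCorner e f x → x + x = 0 → x = 0)
    (hfe : ∀ x, InCorner f e x → x + x = 0 → x = 0)
    (hwe : IsFaithfulCorner e f) (hwf : IsFaithfulCorner f e)
    (he : HasCentralLifts e) (hf : HasCentralLifts f)
    (hQ : NoCentralMultiples e ∨ NoCentralMultiples f ∨ HasTrivialAnnihilators e f) :
    HasLHDProperty R G := by
  intro L hL
  have hφ := hL.isLieDeformation
  obtain ⟨u, hu, hd⟩ := h.exists_unit_conj_commute (hφ.coeff_zero e)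
  have hψ := hφ.conj hu
  obtain ⟨D, hD, hcenter⟩ := hψ.exists_isPeirceDeformation h hef hfe hd he hf
  have hmul := hD.map_mul h hef hfe hwe hwf hQ
  have hc := fun x => commute_of_coeff_mem_center (hcenter x)
  -- The difference of `ψ` and `D` is central, hence unaffected by conjugation with `u`.
  have hsub : ∀ x, generatingMap L x - conjMap u⁻¹ D x = conjMap u (generatingMap L) x - D x := by
    intro x
    have h1 : generatingMap L x = u * conjMap u (generatingMap L) x * (u⁻¹ : (PowerSeries G)ˣ) := by
      simp only [conjMap_apply, mul_assoc, Units.mul_inv, Units.mul_inv_cancel_left, mul_one]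
    rw [h1, conjMap_apply u⁻¹, inv_inv, ← sub_mul, ← mul_sub, ← hc, mul_assoc, Units.mul_inv, mul_one]
  -- Commutators do not see the central difference, and `D` is multiplicative, so both maps agree on
  -- commutators.
  have hlie : ∀ x y, conjMap u (generatingMap L) (x * y - y * x) = D (x * y - y * x) := by
    intro x y
    have hx : ∀ x, ∃ s : PowerSeries G, (∀ t, s * t = t * s) ∧
        conjMap u (generatingMap L) x = D x + s := fun x => ⟨_, hc x, by abel⟩
    obtain ⟨s, hs, hsx⟩ := hx x
    obtain ⟨t, ht, hty⟩ := hx y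
    rw [hψ.map_lie, map_sub, hmul, hmul, hsx, hty, add_mul, add_mul, mul_add, mul_add, mul_add,
      mul_add, hs (D y), ht (D x), hs t]
    abel
  refine ⟨coeffMap (conjMap u⁻¹ D), fun k => L k - coeffMap (conjMap u⁻¹ D) k,
    isHigherDerivation_coeffMap (coeff_zero_conjMap (coeff_zero_units_inv hu) hD.coeff_zero) fun x y => ?_,
    fun k _ x => ?_, fun k _ x y => ?_, fun k _ => (add_sub_cancel _ _).symm⟩
  · rw [conjMap_apply_mul, conjMap_apply, hmul]
  · change L k x - coeff k (conjMap u⁻¹ D x) ∈ _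
    rw [← coeff_generatingMap L, ← map_sub, hsub]
    exact hcenter x k
  · change L k _ - coeff k (conjMap u⁻¹ D _) = 0
    rw [← coeff_generatingMap L, ← map_sub, hsub, Ring.lie_def, hlie, sub_self, map_zero]

end LieHigherDerivation

/-- The case `a = 1` makes `z` central, so its left multiples form a two-sided ideal, which is
central by assumption. -/
theorem HasNoNonzeroCentralIdeal.eq_zero {A : Type*} [Ring A] (h : HasNoNonzeroCentralIdeal A)
    {z : A} (hz : ∀ a, a * z ∈ Set.center A) : z = 0 := by
  have hcomm : ∀ a b, a * z * b = b * (a * z) := fun a => (Set.mem_center_iff.1 (hz a)).comm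
  have hz1 : ∀ b, z * b = b * z := by simpa using hcomm 1
  let I : TwoSidedIdeal A := TwoSidedIdeal.mk' {x | ∃ a, x = a * z} ⟨0, by simp⟩
    (by rintro _ _ ⟨a, rfl⟩ ⟨b, rfl⟩; exact ⟨a + b, by rw [add_mul]⟩)
    (by rintro _ ⟨a, rfl⟩; exact ⟨-a, by rw [neg_mul]⟩)
    (by rintro x _ ⟨a, rfl⟩; exact ⟨x * a, by rw [mul_assoc]⟩)
    (by rintro _ x ⟨a, rfl⟩; exact ⟨a * x, by rw [mul_assoc, hz1, mul_assoc]⟩)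
  have hI : ∀ x, x ∈ I ↔ ∃ a, x = a * z := fun x => TwoSidedIdeal.mem_mk' ..
  have hbot := h I fun x hx => by
    obtain ⟨a, rfl⟩ := (hI x).1 hx
    exact hz a
  exact (TwoSidedIdeal.mem_bot A).1 (hbot ▸ (hI z).2 ⟨1, by rw [one_mul]⟩)

/-! ### Verification for generalized matrix algebras. -/

namespace GenMatrixAlgebra

variable {R A B M N : Type*} [CommRing R]
  [Ring A] [Algebra R A] [Ring B] [Algebra R B]
  [AddCommGroup M] [Module R M] [Module A M] [Module Bᵐᵒᵖ M]
  [AddCommGroup N] [Module R N] [Module B N] [Module Aᵐᵒᵖ N]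

/-- The upper left diagonal idempotent. -/
def e₁ (c : MoritaContext R A B M N) : GenMatrixAlgebra c := ⟨1, 0, 0, 0⟩

/-- The lower right diagonal idempotent. -/
def e₂ (c : MoritaContext R A B M N) : GenMatrixAlgebra c := ⟨0, 0, 0, 1⟩

variable {c : MoritaContext R A B M N}

theorem inCorner_e₁_e₁ {x : GenMatrixAlgebra c} :
    InCorner (e₁ c) (e₁ c) x ↔ x = ⟨x.a11, 0, 0, 0⟩ := by
  simp [InCorner, e₁, GenMatrixAlgebra.ext_iff]
  tauto

theorem inCorner_e₁_e₂ {x : GenMatrixAlgebra c} :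
    InCorner (e₁ c) (e₂ c) x ↔ x = ⟨0, x.a12, 0, 0⟩ := by
  simp [InCorner, e₁, e₂, GenMatrixAlgebra.ext_iff]
  tauto

theorem inCorner_e₂_e₁ {x : GenMatrixAlgebra c} :
    InCorner (e₂ c) (e₁ c) x ↔ x = ⟨0, 0, x.a21, 0⟩ := by
  simp [InCorner, e₁, e₂, GenMatrixAlgebra.ext_iff]
  tauto

theorem inCorner_e₂_e₂ {x : GenMatrixAlgebra c} :
    InCorner (e₂ c) (e₂ c) x ↔ x = ⟨0, 0, 0, x.a22⟩ := by
  simp [InCorner, e₂, GenMatrixAlgebra.ext_iff]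
  tauto

theorem a12_eq_zero_of_mem_center {z : GenMatrixAlgebra c} (hz : z ∈ Set.center _) :
    z.a12 = 0 := by
  have := congrArg a12 ((Set.mem_center_iff.1 hz).comm (e₁ c))
  simpa [e₁] using this.symm

theorem a21_eq_zero_of_mem_center {z : GenMatrixAlgebra c} (hz : z ∈ Set.center _) :
    z.a21 = 0 := by
  have := congrArg a21 ((Set.mem_center_iff.1 hz).comm (e₁ c))
  simpa [e₁] using this

theorem smul_a12_of_mem_center {z : GenMatrixAlgebra c} (hz : z ∈ Set.center _) (m : M) :
    z.a11 • m = op z.a22 • m := by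
  have := congrArg a12 ((Set.mem_center_iff.1 hz).comm (⟨0, m, 0, 0⟩ : GenMatrixAlgebra c))
  simpa using this

theorem smul_a21_of_mem_center {z : GenMatrixAlgebra c} (hz : z ∈ Set.center _) (n : N) :
    z.a22 • n = op z.a11 • n := by
  have := congrArg a21 ((Set.mem_center_iff.1 hz).comm (⟨0, 0, n, 0⟩ : GenMatrixAlgebra c))
  simpa using this

/-- A central matrix is diagonal and its two entries act equally on `M` and on `N`. If one entry is
zero, the other annihilates both bimodules. -/
theorem eq_zero_of_a11_eq_zero (hwf : IsWeaklyFaithful c) {z : GenMatrixAlgebra c}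
    (hz : z ∈ Set.center _) (h : z.a11 = 0) : z = 0 := by
  ext
  · exact h
  · exact a12_eq_zero_of_mem_center hz
  · exact a21_eq_zero_of_mem_center hz
  · exact hwf.2 _ (fun m => by rw [← smul_a12_of_mem_center hz, h, zero_smul])
      (fun n => by rw [smul_a21_of_mem_center hz, h, op_zero, zero_smul])

theorem eq_zero_of_a22_eq_zero (hwf : IsWeaklyFaithful c) {z : GenMatrixAlgebra c}
    (hz : z ∈ Set.center _) (h : z.a22 = 0) : z = 0 := by
  ext
  · exact hwf.1 _ (fun m => by rw [smul_a12_of_mem_center hz, h, op_zero, zero_smul])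
      (fun n => by rw [← smul_a21_of_mem_center hz, h, zero_smul])
  · exact a12_eq_zero_of_mem_center hz
  · exact a21_eq_zero_of_mem_center hz
  · exact h

variable [SMulCommClass A Bᵐᵒᵖ M] [SMulCommClass B Aᵐᵒᵖ N]

theorem isPeircePair : IsPeircePair (e₁ c) (e₂ c) := by
  constructor <;> ext <;> simp [e₁, e₂]

theorem hasCentralLifts_e₁ (hwf : IsWeaklyFaithful c)
    (hA : πA c '' Set.center (GenMatrixAlgebra c) = Set.center A) : HasCentralLifts (e₁ c) where
  exists_lift a ha hcomm := by
    have hmem : a.a11 ∈ Set.center A := Semigroup.mem_center_iff.2 fun y => by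
      have := congrArg a11 (hcomm ⟨y, 0, 0, 0⟩ (inCorner_e₁_e₁.2 rfl))
      simpa using this.symm
    rw [← hA] at hmem
    obtain ⟨z, hz, hza⟩ := hmem
    refine ⟨z, hz, ?_⟩
    rw [inCorner_e₁_e₁.1 ha, ← hza]
    ext <;> simp [e₁, πA, a12_eq_zero_of_mem_center hz]
  eq_zero z hz h := eq_zero_of_a11_eq_zero hwf hz (by simpa [e₁] using congrArg a11 h)

theorem hasCentralLifts_e₂ (hwf : IsWeaklyFaithful c)
    (hB : πB c '' Set.center (GenMatrixAlgebra c) = Set.center B) : HasCentralLifts (e₂ c) where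
  exists_lift b hb hcomm := by
    have hmem : b.a22 ∈ Set.center B := Semigroup.mem_center_iff.2 fun y => by
      have := congrArg a22 (hcomm ⟨0, 0, 0, y⟩ (inCorner_e₂_e₂.2 rfl))
      simpa using this.symm
    rw [← hB] at hmem
    obtain ⟨z, hz, hzb⟩ := hmem
    refine ⟨z, hz, ?_⟩
    rw [inCorner_e₂_e₂.1 hb, ← hzb]
    ext <;> simp [e₂, πB, a21_eq_zero_of_mem_center hz]
  eq_zero z hz h := eq_zero_of_a22_eq_zero hwf hz (by simpa [e₂] using congrArg a22 h)

theorem isFaithfulCorner_e₁ (hwf : IsWeaklyFaithful c) : IsFaithfulCorner (e₁ c) (e₂ c) := by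
  intro a ha hM hN
  rw [inCorner_e₁_e₁.1 ha, hwf.1 a.a11 (fun m => ?_) (fun n => ?_)]
  · rfl
  · simpa using congrArg a12 (hM ⟨0, m, 0, 0⟩ (inCorner_e₁_e₂.2 rfl))
  · simpa using congrArg a21 (hN ⟨0, 0, n, 0⟩ (inCorner_e₂_e₁.2 rfl))

theorem isFaithfulCorner_e₂ (hwf : IsWeaklyFaithful c) : IsFaithfulCorner (e₂ c) (e₁ c) := by
  intro b hb hN hM
  rw [inCorner_e₂_e₂.1 hb, hwf.2 b.a22 (fun m => ?_) (fun n => ?_)]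
  · rfl
  · simpa using congrArg a12 (hM ⟨0, m, 0, 0⟩ (inCorner_e₁_e₂.2 rfl))
  · simpa using congrArg a21 (hN ⟨0, 0, n, 0⟩ (inCorner_e₂_e₁.2 rfl))

theorem noCentralMultiples_e₁ (hwf : IsWeaklyFaithful c) (h : HasNoNonzeroCentralIdeal A) :
    NoCentralMultiples (e₁ c) := by
  intro z hz hcomm
  refine eq_zero_of_a11_eq_zero hwf hz (h.eq_zero fun a => Semigroup.mem_center_iff.2 fun y => ?_)
  have := congrArg a11 (hcomm ⟨a, 0, 0, 0⟩ (inCorner_e₁_e₁.2 rfl) ⟨y, 0, 0, 0⟩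
    (inCorner_e₁_e₁.2 rfl))
  simpa using this.symm

theorem noCentralMultiples_e₂ (hwf : IsWeaklyFaithful c) (h : HasNoNonzeroCentralIdeal B) :
    NoCentralMultiples (e₂ c) := by
  intro z hz hcomm
  refine eq_zero_of_a22_eq_zero hwf hz (h.eq_zero fun b => Semigroup.mem_center_iff.2 fun y => ?_)
  have := congrArg a22 (hcomm ⟨0, 0, 0, b⟩ (inCorner_e₂_e₂.2 rfl) ⟨0, 0, 0, y⟩
    (inCorner_e₂_e₂.2 rfl))
  simpa using this.symm

/-- A strongly faithful bimodule forces an entry of `z`, and with it `z`, or the off-diagonal factor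
to vanish. Without zero divisors the same dichotomy is applied to `z.a11 * Φ m n = 0` and `z.a22 * Ψ
n m = 0`. -/
theorem hasTrivialAnnihilators (hwf : IsWeaklyFaithful c)
    (h : (NoZeroDivisors A ∧ NoZeroDivisors B) ∨
      (IsStronglyFaithful A B M ∨ IsStronglyFaithful B A N)) :
    HasTrivialAnnihilators (e₁ c) (e₂ c) := by
  intro z hz x y hx hy hzx hzy
  rw [inCorner_e₁_e₂] at hx
  rw [inCorner_e₂_e₁] at hy
  generalize x.a12 = m at hx
  generalize y.a21 = n at hy
  subst hx hy
  have hm : z.a11 • m = 0 := by simpa using congrArg a12 hzx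
  have hm' : op z.a22 • m = 0 := by rw [← smul_a12_of_mem_center hz, hm]
  have hn : z.a22 • n = 0 := by simpa using congrArg a21 hzy
  have hn' : op z.a11 • n = 0 := by rw [← smul_a21_of_mem_center hz, hn]
  have h1 := eq_zero_of_a11_eq_zero hwf hz
  have h2 := eq_zero_of_a22_eq_zero hwf hz
  have hprod : c.Φ m n = 0 → c.Ψ n m = 0 →
      (⟨0, m, 0, 0⟩ : GenMatrixAlgebra c) * ⟨0, 0, n, 0⟩ = 0 ∧
        (⟨0, 0, n, 0⟩ : GenMatrixAlgebra c) * ⟨0, m, 0, 0⟩ = 0 := fun h h' =>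
    ⟨by ext <;> simp [h], by ext <;> simp [h']⟩
  have hprod_m : m = 0 → _ := fun h => hprod (by simp [h]) (by simp [h])
  have hprod_n : n = 0 → _ := fun h => hprod (by simp [h]) (by simp [h])
  rcases h with ⟨_, _⟩ | (⟨_, h⟩ | ⟨_, h⟩) | ⟨_, h⟩ | ⟨_, h⟩
  · have hA : z.a11 * c.Φ m n = 0 := by rw [← c.Φ_left, hm, map_zero, LinearMap.zero_apply]
    have hB : z.a22 * c.Ψ n m = 0 := by rw [← c.Ψ_left, hn, map_zero, LinearMap.zero_apply]
    rcases mul_eq_zero.1 hA with hA | hA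
    · exact Or.inl (h1 hA)
    rcases mul_eq_zero.1 hB with hB | hB
    · exact Or.inl (h2 hB)
    exact Or.inr (hprod hA hB)
  · exact (h _ _ hm).imp h1 hprod_m
  · exact (h _ _ hm').symm.imp h2 hprod_m
  · exact (h _ _ hn).imp h2 hprod_n
  · exact (h _ _ hn').symm.imp h1 hprod_n

end GenMatrixAlgebra

theorem mainTheorem1 {R A B M N : Type*} [CommRing R]
    [Ring A] [Algebra R A] [Ring B] [Algebra R B]
    [AddCommGroup M] [Module R M] [Module A M] [Module Bᵐᵒᵖ M]
    [SMulCommClass A Bᵐᵒᵖ M] [IsScalarTower R A M] [IsScalarTower R Bᵐᵒᵖ M]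
    [AddCommGroup N] [Module R N] [Module B N] [Module Aᵐᵒᵖ N]
    [SMulCommClass B Aᵐᵒᵖ N] [IsScalarTower R B N] [IsScalarTower R Aᵐᵒᵖ N]
    (c : MoritaContext R A B M N)
    (_hMN : Nontrivial M ∨ Nontrivial N)
    (hM2 : ∀ m : M, (2 : ℕ) • m = 0 → m = 0)
    (hN2 : ∀ n : N, (2 : ℕ) • n = 0 → n = 0)
    (hwf : GenMatrixAlgebra.IsWeaklyFaithful c)
    (hA : GenMatrixAlgebra.πA c '' Set.center (GenMatrixAlgebra c) = Set.center A)
    (hB : GenMatrixAlgebra.πB c '' Set.center (GenMatrixAlgebra c) = Set.center B)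
    (h : (HasNoNonzeroCentralIdeal A ∨ HasNoNonzeroCentralIdeal B) ∨
      (NoZeroDivisors A ∧ NoZeroDivisors B) ∨
      (IsStronglyFaithful A B M ∨ IsStronglyFaithful B A N)) :
    HasLHDProperty R (GenMatrixAlgebra c) := by
  refine GenMatrixAlgebra.isPeircePair.hasLHDProperty (fun x hx h2 => ?_) (fun x hx h2 => ?_)
    (GenMatrixAlgebra.isFaithfulCorner_e₁ hwf) (GenMatrixAlgebra.isFaithfulCorner_e₂ hwf)
    (GenMatrixAlgebra.hasCentralLifts_e₁ hwf hA) (GenMatrixAlgebra.hasCentralLifts_e₂ hwf hB) ?_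
  · rw [GenMatrixAlgebra.inCorner_e₁_e₂.1 hx, hM2 x.a12 (by
      rw [two_nsmul]; exact congrArg GenMatrixAlgebra.a12 h2)]
    rfl
  · rw [GenMatrixAlgebra.inCorner_e₂_e₁.1 hx, hN2 x.a21 (by
      rw [two_nsmul]; exact congrArg GenMatrixAlgebra.a21 h2)]
    rfl
  · rcases h with (h | h) | h
    · exact Or.inl (GenMatrixAlgebra.noCentralMultiples_e₁ hwf h)
    · exact Or.inr (Or.inl (GenMatrixAlgebra.noCentralMultiples_e₂ hwf h))
    · exact Or.inr (Or.inr (GenMatrixAlgebra.hasTrivialAnnihilators hwf h))
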